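/- Let $K$ be a field, $R=K[x,y,z]$ with its standard grading, and let $R(c)$ denote the graded module with $R(c)_n=R_{c+n}$. Let $I\subseteq R$ be the homogeneous ideal of $r\ge 3$ distinct $K$-rational points of $\mathbb{P}^2_K$ lying on a conic that is irreducible over $K$, let $m\ge 0$ be an integer, and let $I^{(m)}=\bigcap_{P\in\mathrm{Ass}(R/I)}(I^mR_P\cap R)$ be the $m$-th symbolic power of $I$ (so $I^{(0)}=R$). In each of the cases below, $I^{(m)}$ has a graded minimal free resolution of the form $$0\to G_1\to G_0\to I^{(m)}\to 0,$$ with $G_0$ and $G_1$ the graded free modules given there (empty sums are $0$); and in every graded minimal free resolution of $I^{(m)}$ of this form, with $G_0,G_1$ finite direct sums of modules $R(c)$, the twists occurring in $G_0$ and in $G_1$, counted with multiplicity, are the ones given. (a) If $r$ is even, $$G_0=\bigoplus_{j=0}^{m}R\Big(-2(m-j)-\frac{rj}{2}\Big),\qquad G_1=\bigoplus_{j=1}^{m}R\Big(-2(m-j)-\frac{rj}{2}-2\Big).$$ (b) If $r\ge 5$ is odd and $m$ is even, $$G_0=\bigoplus_{j=0}^{m/2}R\big(-2m-j(r-4)\big)\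 \oplus\ \bigoplus_{j=0}^{m/2-1}R\Big(-2m-j(r-4)-\frac{r-1}{2}+1\Big)^{2},$$ $$G_1=\bigoplus_{j=1}^{m/2}R\big(-2m-j(r-4)-2\big)\ \oplus\ \bigoplus_{j=0}^{m/2-1}R\Big(-2m-j(r-4)-\frac{r-1}{2}\Big)^{2}.$$ (c) If $r=3$ and $m$ is even, $$G_0=R\Big(-\frac{3m}{2}\Big)\ \oplus\ \bigoplus_{j=0}^{m/2-1}R\Big(-\frac{3m}{2}-j-1\Big)^{3},\qquad G_1=\bigoplus_{j=0}^{m/2-1}R\Big(-\frac{3m}{2}-j-2\Big)^{3}.$$ -/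

import Mathlib

open MvPolynomial

noncomputable section

namespace PlanePoints

/-- The homogeneous coordinate ring `R = K[x, y, z]` of the projective plane. -/
abbrev CoordRing (K : Type*) [Field K] : Type _ := MvPolynomial (Fin 3) K

/-- The projective plane over `K` (its `K`-points). -/
abbrev Plane (K : Type*) [Field K] : Type _ := Projectivization K (Fin 3 → K)

variable {K : Type*} [Field K]

/-- `f` vanishes at the point `p`, i.e. at every vector of homogeneous coordinates of `p`. -/
def VanishesAt (f : CoordRing K) (p : Plane K) : Prop :=
  ∀ (v : Fin 3 → K) (hv : v ≠ 0), Projectivization.mk K v hv = p → eval v f = 0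

/-- The homogeneous ideal of a set of points of the plane: it is generated by the
homogeneous polynomials vanishing at all of the points. -/
def idealOfPoints (Z : Set (Plane K)) : Ideal (CoordRing K) :=
  Ideal.span {f | (∃ n : ℕ, f.IsHomogeneous n) ∧ ∀ p ∈ Z, VanishesAt f p}

/-- The points of `Z` lie on an irreducible conic. -/
def OnIrreducibleConic (Z : Set (Plane K)) : Prop :=
  ∃ Q : CoordRing K, Q.IsHomogeneous 2 ∧ Irreducible Q ∧ ∀ p ∈ Z, VanishesAt Q p

/-- The symbolic power `I^(m)`: the intersection, over the associated primes `P` of `A ⧸ I`,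
of the contractions to `A` of the ideals `I ^ m A_P`. -/
def symbolicPower {A : Type*} [CommRing A] (I : Ideal A) (m : ℕ) : Ideal A :=
  ⨅ P : associatedPrimes A (A ⧸ I),
    haveI : P.1.IsPrime := P.2.isPrime
    ((I ^ m).map (algebraMap A (Localization.AtPrime P.1))).comap
      (algebraMap A (Localization.AtPrime P.1))

variable (K) in
/-- The homogeneous piece `R_n` of `R = K[x, y, z]` for an integer `n`; zero for `n < 0`. -/
def piece (n : ℤ) : Submodule K (CoordRing K) :=
  if 0 ≤ n then homogeneousSubmodule (Fin 3) K n.toNat else ⊥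

/-- The degree `n` piece of the graded free module `⨁ i, R(a i)`, where `R(c)_n = R_{c + n}`. -/
def twistedPiece {ι : Type*} (a : ι → ℤ) (n : ℤ) : Set (ι → CoordRing K) :=
  {v | ∀ i, v i ∈ piece K (a i + n)}

/-- A graded minimal free resolution `0 → ⨁ j, R(b j) → ⨁ i, R(a i) → J → 0` of an ideal `J` of
`R = K[x, y, z]`, with maps that preserve degrees. -/
structure MinimalFreeResolution (J : Ideal (CoordRing K)) {ι κ : Type*}
    (a : ι → ℤ) (b : κ → ℤ) where
  /-- the map `G₁ → G₀` -/
  d : (κ → CoordRing K) →ₗ[CoordRing K] (ι → CoordRing K)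
  /-- the map `G₀ → J` -/
  ε : (ι → CoordRing K) →ₗ[CoordRing K] J
  d_graded : ∀ (n : ℤ), ∀ v ∈ twistedPiece b n, d v ∈ twistedPiece a n
  ε_graded : ∀ (n : ℤ), ∀ v ∈ twistedPiece a n, (ε v : CoordRing K) ∈ piece K n
  d_injective : Function.Injective d
  exact : Function.Exact d ε
  ε_surjective : Function.Surjective ε
  /-- minimality: the image of `G₁` is contained in `(x, y, z) G₀` -/
  minimal : ∀ v i, d v i ∈ Ideal.span (Set.range (X : Fin 3 → CoordRing K))

/-- `J` has a graded minimal free resolution `0 → G₁ → G₀ → J → 0` in which `G₀` is the direct sum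
of the `R(c)` with `c` in the multiset `A`, and `G₁` that of the `R(c)` with `c` in `B`. -/
def HasMinimalFreeResolution (J : Ideal (CoordRing K)) (A B : Multiset ℤ) : Prop :=
  ∃ (s t : ℕ) (a : Fin s → ℤ) (b : Fin t → ℤ),
    Finset.univ.val.map a = A ∧ Finset.univ.val.map b = B ∧
      Nonempty (MinimalFreeResolution J a b)

/-- `⨁_{j ∈ S} R(c j)`, as the multiset of its twists. -/
def twists (S : Finset ℕ) (c : ℤ → ℤ) : Multiset ℤ := S.val.map fun j => c j

end PlanePoints

end

/-! Two distinct points of the irreducible conic allow linear coordinates in which it is q = l₀l₂ -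
l₁², parametrized by (s² : st : t²). On coordinate rings, the parametrization R → K[s,t] has kernel
(q), and its image is the part of even degree. The r points correspond to pairwise coprime linear
forms in s, t, with product g.

Two facts control the symbolic powers. First, I^(m+1) : q = I^(m) (`conic_mul_mem_sym`,
`mem_sym_of_conic_mul_mem`), because q is part of a pair generating the ideal of each point locally.
Second, the image of I^(m) consists of multiples g^m y in which y has the parity of rm
(`exists_param_eq`). So I^(m) is built from lower symbolic powers times powers of q and from lifts
of such multiples.

If r is even, g lifts to a form F of degree r/2, and I^(m+1) = q I^(m) + (F^(m+1)); the only new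
relation is q · F^(m+1) = q · (F · F^m). If r is odd, only g², sg and tg lift, to forms F, A, B with
F singular at every point. Going up two steps, I^(2μ+2) = q² I^(2μ) + (F^(μ+1), q F^μ A, q F^μ B),
with three new relations, each involving only the generator F^μ of I^(2μ). In both cases
`MinimalFreeResolution.exists_extend` enlarges the resolution, and induction gives the twists. The
case r = 3 is the odd formula rearranged.

Uniqueness of the twists (`HasMinimalFreeResolution.unique`) is the comparison of two resolutions
modulo (x, y, z), done on the matrices of constant terms. -/

namespace PlanePoints

/-! ### Components of a product with a weighted homogeneous factor -/

section Grading

variable {σ S M : Type*} [CommRing S] [AddCommGroup M]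

/-- The weights lie in an arbitrary group because two gradings are needed: integral degree on R and
degree modulo 2 on K[s,t]. -/
theorem weightedHomogeneousComponent_mul_of_left {w : σ → M} {f : MvPolynomial σ S} {m : M}
    (hf : IsWeightedHomogeneous w f m) (n : M) (g : MvPolynomial σ S) :
    weightedHomogeneousComponent w n (f * g) = f * weightedHomogeneousComponent w (n - m) g := by
  classical
  let := weightedGradedAlgebra S w
  have h := DirectSum.coe_decompose_mul_add_of_left_mem (weightedHomogeneousSubmodule S w)
    (i := m) (j := n - m) (b := g) hf
  rw [add_sub_cancel] at h
  have key : ∀ (p : MvPolynomial σ S) (i : M),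
      ((DirectSum.decompose (weightedHomogeneousSubmodule S w) p i :
        weightedHomogeneousSubmodule S w i) : MvPolynomial σ S)
        = weightedHomogeneousComponent w i p :=
    fun p i => weightedDecomposition.decompose'_apply S w p i
  rwa [key, key] at h

theorem isWeightedHomogeneous_of_mul_left [IsDomain S] {w : σ → M} {f g : MvPolynomial σ S}
    {m n : M} (hf : IsWeightedHomogeneous w f m) (hf0 : f ≠ 0)
    (h : IsWeightedHomogeneous w (f * g) n) : IsWeightedHomogeneous w g (n - m) := by
  have h1 := weightedHomogeneousComponent_mul_of_left hf n g
  rw [h.weightedHomogeneousComponent_same] at h1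
  rw [mul_left_cancel₀ hf0 h1]
  exact weightedHomogeneousComponent_isWeightedHomogeneous (w := w) (n - m) g

end Grading

/-! ### Integral degrees, twisted pieces and their projections -/

section Pieces

variable {K : Type*} [Field K]

theorem weight_one_int {σ : Type*} (d : σ →₀ ℕ) :
    Finsupp.weight (fun _ : σ => (1 : ℤ)) d = (d.degree : ℤ) := by
  simp [Finsupp.weight_apply, Finsupp.degree_apply, Finsupp.sum]

theorem isWeightedHomogeneous_one_int {σ S : Type*} [CommSemiring S] {f : MvPolynomial σ S}
    {n : ℕ} : IsWeightedHomogeneous (fun _ : σ => (1 : ℤ)) f (n : ℤ) ↔ f.IsHomogeneous n := by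
  constructor
  · intro h d hd
    have := h hd
    rw [weight_one_int] at this
    rw [Pi.one_def, ← Finsupp.degree_eq_weight_one]
    exact_mod_cast this
  · intro h d hd
    rw [weight_one_int]
    have := h hd
    rw [Pi.one_def, ← Finsupp.degree_eq_weight_one] at this
    exact_mod_cast this

/-- Using weights in ℤ makes negative degrees harmless: no monomial has negative degree, so only
zero is homogeneous there. -/
theorem mem_piece_iff {n : ℤ} {f : CoordRing K} :
    f ∈ piece K n ↔ IsWeightedHomogeneous (fun _ : Fin 3 => (1 : ℤ)) f n := by
  unfold piece
  split_ifs with h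
  · lift n to ℕ using h
    rw [isWeightedHomogeneous_one_int]
    simp [mem_homogeneousSubmodule]
  · constructor
    · intro hf
      rw [Submodule.mem_bot] at hf
      rw [hf]
      exact isWeightedHomogeneous_zero _ _ _
    · intro hf
      rw [Submodule.mem_bot]
      ext d
      by_contra hd
      have := hf hd
      rw [weight_one_int] at this
      omega

theorem mem_piece_natCast {n : ℕ} {f : CoordRing K} :
    f ∈ piece K (n : ℤ) ↔ f.IsHomogeneous n := by
  rw [mem_piece_iff, isWeightedHomogeneous_one_int]

theorem mul_mem_piece {m n : ℤ} {f g : CoordRing K} (hf : f ∈ piece K m) (hg : g ∈ piece K n) :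
    f * g ∈ piece K (m + n) := by
  rw [mem_piece_iff] at *
  exact hf.mul hg

theorem one_mem_piece : (1 : CoordRing K) ∈ piece K 0 := by
  rw [mem_piece_iff]
  exact isWeightedHomogeneous_one _ _

theorem constantCoeff_eq_zero_of_mem_piece {n : ℤ} (hn : n ≠ 0) {f : CoordRing K}
    (hf : f ∈ piece K n) : constantCoeff f = 0 := by
  rw [mem_piece_iff] at hf
  rw [constantCoeff_eq]
  exact hf.coeff_eq_zero _ (by simpa using hn.symm)

theorem constantCoeff_eq_zero_of_mem_irrelevant {f : CoordRing K}
    (hf : f ∈ Ideal.span (Set.range (X : Fin 3 → CoordRing K))) : constantCoeff f = 0 := by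
  have h : Ideal.span (Set.range (X : Fin 3 → CoordRing K)) ≤ RingHom.ker constantCoeff := by
    rw [Ideal.span_le]
    rintro _ ⟨i, rfl⟩
    simp
  exact h hf

theorem mem_irrelevant_of_constantCoeff_eq_zero {f : CoordRing K}
    (hf : constantCoeff f = 0) : f ∈ Ideal.span (Set.range (X : Fin 3 → CoordRing K)) := by
  rw [← Set.image_univ, mem_ideal_span_X_image]
  intro d hd
  have hd0 : d ≠ 0 := by
    rintro rfl
    rw [mem_support_iff] at hd
    exact hd hf
  obtain ⟨i, hi⟩ := Finsupp.ne_iff.1 hd0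
  exact ⟨i, trivial, hi⟩

theorem mem_irrelevant_of_isHomogeneous {n : ℕ} (hn : n ≠ 0) {f : CoordRing K}
    (hf : f.IsHomogeneous n) : f ∈ Ideal.span (Set.range (X : Fin 3 → CoordRing K)) :=
  mem_irrelevant_of_constantCoeff_eq_zero
    (constantCoeff_eq_zero_of_mem_piece (n := n) (by exact_mod_cast hn) (mem_piece_natCast.2 hf))

variable (K) in
/-- The homogeneous component of integral degree `n`. -/
noncomputable def pieceProj (n : ℤ) : CoordRing K →ₗ[K] CoordRing K :=
  weightedHomogeneousComponent (fun _ : Fin 3 => (1 : ℤ)) n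

theorem pieceProj_mem (n : ℤ) (f : CoordRing K) : pieceProj K n f ∈ piece K n :=
  mem_piece_iff.2 (weightedHomogeneousComponent_isWeightedHomogeneous (w := fun _ => 1) n f)

theorem pieceProj_of_mem {n : ℤ} {f : CoordRing K} (hf : f ∈ piece K n) : pieceProj K n f = f :=
  (mem_piece_iff.1 hf).weightedHomogeneousComponent_same

theorem pieceProj_mul {m : ℤ} {f : CoordRing K} (hf : f ∈ piece K m) (n : ℤ) (g : CoordRing K) :
    pieceProj K n (f * g) = f * pieceProj K (n - m) g :=
  weightedHomogeneousComponent_mul_of_left (mem_piece_iff.1 hf) n g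

/-- The projection of `⨁ i, R(a i)` onto its degree `n` piece. -/
noncomputable def twistedProj {ι : Type*} (a : ι → ℤ) (n : ℤ) (v : ι → CoordRing K) :
    ι → CoordRing K :=
  fun i => pieceProj K (a i + n) (v i)

theorem twistedProj_mem {ι : Type*} (a : ι → ℤ) (n : ℤ) (v : ι → CoordRing K) :
    twistedProj a n v ∈ twistedPiece a n :=
  fun _ => pieceProj_mem _ _

theorem twistedProj_of_mem {ι : Type*} {a : ι → ℤ} {n : ℤ} {v : ι → CoordRing K}
    (hv : v ∈ twistedPiece a n) : twistedProj a n v = v :=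
  funext fun i => pieceProj_of_mem (hv i)

theorem single_mem_twistedPiece {ι : Type*} [DecidableEq ι] (a : ι → ℤ) (i : ι) :
    (Pi.single i 1 : ι → CoordRing K) ∈ twistedPiece a (-a i) := by
  intro j
  by_cases h : j = i
  · subst h
    simpa using one_mem_piece
  · rw [Pi.single_eq_of_ne h]
    exact zero_mem _

theorem linearMap_apply_eq_sum {ι A N : Type*} [CommRing A] [AddCommGroup N] [Module A N]
    [Fintype ι] [DecidableEq ι] (φ : (ι → A) →ₗ[A] N) (v : ι → A) :
    φ v = ∑ i, v i • φ (Pi.single i 1) := by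
  conv_lhs => rw [← (Pi.basisFun A ι).sum_repr v, map_sum]
  simp

/-- Graded maps commute with taking components. This is what allows an arbitrary preimage to be
replaced by a homogeneous one. -/
theorem pieceProj_linearMap {ι : Type*} [Fintype ι] [DecidableEq ι] {a : ι → ℤ} {c : ℤ}
    (φ : (ι → CoordRing K) →ₗ[CoordRing K] CoordRing K)
    (hφ : ∀ i, φ (Pi.single i 1) ∈ piece K (c - a i)) (n : ℤ) (v : ι → CoordRing K) :
    pieceProj K (c + n) (φ v) = φ (twistedProj a n v) := by
  rw [linearMap_apply_eq_sum φ v, linearMap_apply_eq_sum φ (twistedProj a n v), map_sum]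
  refine Finset.sum_congr rfl fun i _ => ?_
  rw [smul_eq_mul, smul_eq_mul, mul_comm, pieceProj_mul (hφ i), mul_comm]
  congr 2
  ring_nf

theorem twistedProj_linearMap {ι κ : Type*} [Fintype κ] [DecidableEq κ] {a : ι → ℤ} {b : κ → ℤ}
    (φ : (κ → CoordRing K) →ₗ[CoordRing K] (ι → CoordRing K))
    (hφ : ∀ j, φ (Pi.single j 1) ∈ twistedPiece a (-b j)) (n : ℤ) (v : κ → CoordRing K) :
    twistedProj a n (φ v) = φ (twistedProj b n v) := by
  funext i
  exact pieceProj_linearMap (c := a i) (LinearMap.proj i ∘ₗ φ)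
    (fun j => by simpa [sub_eq_add_neg] using hφ j i) n v

end Pieces

/-! ### Uniqueness of the twists -/

section Uniqueness

variable {K : Type*} [Field K]

theorem count_map_univ {ι β : Type*} [Fintype ι] [DecidableEq β] (f : ι → β) (c : β) :
    Multiset.count c (Finset.univ.val.map f) = Fintype.card {i // f i = c} := by
  rw [Multiset.count_map, Fintype.card_subtype]
  simp only [Finset.card, Finset.filter_val, eq_comm]

/-- Fix a value c. Since P only connects equal labels, the blocks of Q and P with label c still have
product 1, and comparing ranks bounds the multiplicity of c. Nothing is needed about the other
entries of Q. -/
theorem map_le_map_of_matrix_mul_eq_one {ι ι' β : Type*} [Fintype ι] [Fintype ι'] [DecidableEq ι]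
    [DecidableEq β] (a : ι → β) (a' : ι' → β) (P : Matrix ι' ι K) (Q : Matrix ι ι' K)
    (hQP : Q * P = 1) (hP : ∀ i' i, a' i' ≠ a i → P i' i = 0) :
    Finset.univ.val.map a ≤ Finset.univ.val.map a' := by
  rw [Multiset.le_iff_count]
  intro c
  rw [count_map_univ, count_map_univ]
  have h1 : Q.submatrix (Subtype.val : {i // a i = c} → ι) (Subtype.val : {i // a' i = c} → ι') *
      P.submatrix (Subtype.val : {i // a' i = c} → ι') (Subtype.val : {i // a i = c} → ι) = 1 := by
    ext i j
    have h := congrFun (congrFun hQP i.1) j.1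
    rw [Matrix.mul_apply] at h ⊢
    rw [Matrix.one_apply] at h ⊢
    simp only [Subtype.ext_iff]
    rw [← h]
    refine (Finset.sum_subtype (Finset.univ.filter fun i' => a' i' = c) (by simp)
      fun i' => Q i.1 i' * P i' j.1).symm.trans ?_
    refine Finset.sum_filter_of_ne fun i' _ hne => ?_
    by_contra h'
    exact hne (by rw [hP i' j.1 (by rwa [j.2]), mul_zero])
  have h2 := Matrix.rank_mul_le_right
    (Q.submatrix (Subtype.val : {i // a i = c} → ι) (Subtype.val : {i // a' i = c} → ι'))
    (P.submatrix (Subtype.val : {i // a' i = c} → ι') (Subtype.val : {i // a i = c} → ι))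
  rw [h1, Matrix.rank_one] at h2
  exact h2.trans (Matrix.rank_le_card_height _)

/-- The matrices of constant terms of φ and ψ are inverse on one side, and an entry of φ of nonzero
degree has no constant term. -/
theorem map_le_map_of_graded_left_inverse {ι ι' : Type*} [Fintype ι] [Fintype ι'] [DecidableEq ι]
    [DecidableEq ι'] {a : ι → ℤ} {a' : ι' → ℤ}
    (φ : (ι → CoordRing K) →ₗ[CoordRing K] (ι' → CoordRing K))
    (ψ : (ι' → CoordRing K) →ₗ[CoordRing K] (ι → CoordRing K))
    (hφ : ∀ i, φ (Pi.single i 1) ∈ twistedPiece a' (-a i))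
    (h : ∀ i k, (ψ (φ (Pi.single i 1)) - Pi.single i 1 : ι → CoordRing K) k ∈
      Ideal.span (Set.range (X : Fin 3 → CoordRing K))) :
    Finset.univ.val.map a ≤ Finset.univ.val.map a' := by
  refine map_le_map_of_matrix_mul_eq_one a a'
    (Matrix.of fun i' i => constantCoeff (φ (Pi.single i 1) i'))
    (Matrix.of fun i i' => constantCoeff (ψ (Pi.single i' 1) i)) ?_ ?_
  · ext k i
    have h1 := constantCoeff_eq_zero_of_mem_irrelevant (h i k)
    rw [linearMap_apply_eq_sum ψ (φ _), Pi.sub_apply, map_sub, sub_eq_zero] at h1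
    rw [Matrix.mul_apply, Matrix.one_apply]
    simp only [Matrix.of_apply]
    rw [Finset.sum_apply, map_sum] at h1
    simp only [Pi.smul_apply, smul_eq_mul, map_mul] at h1
    simp only [mul_comm] at h1 ⊢
    rw [h1, Pi.single_apply]
    split_ifs <;> simp
  · intro i' i hne
    exact constantCoeff_eq_zero_of_mem_piece (n := a' i' + -a i) (by omega) (hφ i i')

variable {J : Ideal (CoordRing K)}

namespace MinimalFreeResolution

variable {ι κ ι' κ' : Type*} {a : ι → ℤ} {b : κ → ℤ} {a' : ι' → ℤ} {b' : κ' → ℤ}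

theorem d_single_mem [DecidableEq κ] (ρ : MinimalFreeResolution J a b) (j : κ) :
    ρ.d (Pi.single j 1) ∈ twistedPiece a (-b j) :=
  ρ.d_graded _ _ (single_mem_twistedPiece b j)

theorem ε_single_mem [DecidableEq ι] (ρ : MinimalFreeResolution J a b) (i : ι) :
    (ρ.ε (Pi.single i 1) : CoordRing K) ∈ piece K (-a i) :=
  ρ.ε_graded _ _ (single_mem_twistedPiece a i)

theorem exists_lift [Fintype ι] [Fintype ι'] [DecidableEq ι] [DecidableEq ι']
    (ρ : MinimalFreeResolution J a b) (ρ' : MinimalFreeResolution J a' b') :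
    ∃ φ : (ι → CoordRing K) →ₗ[CoordRing K] (ι' → CoordRing K),
      (∀ i, φ (Pi.single i 1) ∈ twistedPiece a' (-a i)) ∧ ∀ v, ρ'.ε (φ v) = ρ.ε v := by
  choose y hy using fun i => ρ'.ε_surjective (ρ.ε (Pi.single i 1))
  refine ⟨(Pi.basisFun _ ι).constr (CoordRing K) fun i => twistedProj a' (-a i) (y i), ?_, ?_⟩
  · intro i
    rw [← Pi.basisFun_apply, Module.Basis.constr_basis]
    exact twistedProj_mem _ _ _
  · have h : ρ'.ε ∘ₗ ((Pi.basisFun _ ι).constr (CoordRing K) fun i => twistedProj a' (-a i) (y i))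
        = ρ.ε := by
      refine (Pi.basisFun _ ι).ext fun i => ?_
      rw [LinearMap.comp_apply, Module.Basis.constr_basis, Pi.basisFun_apply]
      apply Subtype.ext
      have h1 := pieceProj_linearMap (a := a') (c := 0) (J.subtype ∘ₗ ρ'.ε)
        (fun i => by simpa using ρ'.ε_single_mem i) (-a i) (y i)
      simp only [LinearMap.comp_apply, Submodule.subtype_apply, hy, zero_add] at h1
      rw [← h1]
      exact pieceProj_of_mem (ρ.ε_single_mem i)
    exact fun v => LinearMap.congr_fun h v

theorem exists_lift_syzygies [Fintype ι] [Fintype κ] [Fintype κ']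
    [DecidableEq ι] [DecidableEq κ] [DecidableEq κ'] (ρ : MinimalFreeResolution J a b) (ρ' : MinimalFreeResolution J a' b')
    (φ : (ι → CoordRing K) →ₗ[CoordRing K] (ι' → CoordRing K))
    (hφ : ∀ i, φ (Pi.single i 1) ∈ twistedPiece a' (-a i)) (hφε : ∀ v, ρ'.ε (φ v) = ρ.ε v) :
    ∃ φ₁ : (κ → CoordRing K) →ₗ[CoordRing K] (κ' → CoordRing K),
      (∀ j, φ₁ (Pi.single j 1) ∈ twistedPiece b' (-b j)) ∧ ∀ v, ρ'.d (φ₁ v) = φ (ρ.d v) := by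
  have hex : ∀ v, ∃ y, ρ'.d y = φ (ρ.d v) := fun v =>
    (ρ'.exact _).1 (by rw [hφε]; exact (ρ.exact _).2 ⟨v, rfl⟩)
  choose y hy using fun j => hex (Pi.single j 1)
  refine ⟨(Pi.basisFun _ κ).constr (CoordRing K) fun j => twistedProj b' (-b j) (y j), ?_, ?_⟩
  · intro i
    rw [← Pi.basisFun_apply, Module.Basis.constr_basis]
    exact twistedProj_mem _ _ _
  · have h : ρ'.d ∘ₗ ((Pi.basisFun _ κ).constr (CoordRing K) fun j => twistedProj b' (-b j) (y j))
        = φ ∘ₗ ρ.d := by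
      refine (Pi.basisFun _ κ).ext fun j => ?_
      rw [LinearMap.comp_apply, Module.Basis.constr_basis, Pi.basisFun_apply,
        ← twistedProj_linearMap ρ'.d ρ'.d_single_mem, hy, twistedProj_linearMap φ hφ,
        twistedProj_of_mem (ρ.d_single_mem j)]
      rfl
    exact fun v => LinearMap.congr_fun h v

/-- The composite ψφ of two comparison maps differs from the identity by a map into ker ε = im d,
which minimality puts in (x, y, z)G₀. In G₁ the same congruence follows from a homotopy. -/
theorem map_le [Fintype ι] [Fintype κ] [Fintype ι'] [Fintype κ']
    [DecidableEq ι] [DecidableEq κ] [DecidableEq ι'] [DecidableEq κ'] (ρ : MinimalFreeResolution J a b) (ρ' : MinimalFreeResolution J a' b') :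
    Finset.univ.val.map a ≤ Finset.univ.val.map a' ∧
      Finset.univ.val.map b ≤ Finset.univ.val.map b' := by
  obtain ⟨φ, hφ, hφε⟩ := ρ.exists_lift ρ'
  obtain ⟨ψ, hψ, hψε⟩ := ρ'.exists_lift ρ
  obtain ⟨φ₁, hφ₁, hφ₁d⟩ := ρ.exists_lift_syzygies ρ' φ hφ hφε
  obtain ⟨ψ₁, hψ₁, hψ₁d⟩ := ρ'.exists_lift_syzygies ρ ψ hψ hψε
  have hker : ∀ v, ∃ y, ρ.d y = ψ (φ v) - v := fun v =>
    (ρ.exact _).1 (by rw [map_sub, hψε, hφε, sub_self])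
  choose y hy using hker
  refine ⟨map_le_map_of_graded_left_inverse φ ψ hφ fun i k => ?_,
    map_le_map_of_graded_left_inverse φ₁ ψ₁ hφ₁ fun j k => ?_⟩
  · rw [← hy]
    exact ρ.minimal _ _
  -- Here y plays the role of a homotopy. Applying d to both sides gives (ψφ - 1)(d eⱼ), and the
  -- coefficients of d eⱼ lie in (x, y, z).
  · have h1 : ψ₁ (φ₁ (Pi.single j 1)) - Pi.single j 1 =
        ∑ i, ρ.d (Pi.single j 1) i • y (Pi.single i 1) := by
      apply ρ.d_injective
      rw [map_sub, hψ₁d, hφ₁d, map_sum]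
      simp only [map_smul, hy]
      have h2 := linearMap_apply_eq_sum (ψ ∘ₗ φ - LinearMap.id) (ρ.d (Pi.single j 1))
      simpa using h2
    rw [h1, Finset.sum_apply]
    exact Ideal.sum_mem _ fun i _ => Ideal.mul_mem_right _ _ (ρ.minimal _ _)

end MinimalFreeResolution

theorem HasMinimalFreeResolution.unique {A B A' B' : Multiset ℤ}
    (h : HasMinimalFreeResolution J A B) (h' : HasMinimalFreeResolution J A' B') :
    A = A' ∧ B = B' := by
  obtain ⟨s, t, a, b, rfl, rfl, ⟨ρ⟩⟩ := h
  obtain ⟨s', t', a', b', rfl, rfl, ⟨ρ'⟩⟩ := h'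
  exact ⟨le_antisymm (ρ.map_le ρ').1 (ρ'.map_le ρ).1, le_antisymm (ρ.map_le ρ').2 (ρ'.map_le ρ).2⟩

end Uniqueness

/-! ### Enlarging a resolution from J' to q J' + (fᵢ) -/

section Existence

variable {K : Type*} [Field K]

namespace MinimalFreeResolution

variable {J J' : Ideal (CoordRing K)} {ι κ ι' κ' : Type*} {a : ι → ℤ} {b : κ → ℤ}

/-- Transport of a resolution along bijections of the index types. -/
noncomputable def reindex (ρ : MinimalFreeResolution J a b) (e : ι' ≃ ι) (e' : κ' ≃ κ) :
    MinimalFreeResolution J (a ∘ e) (b ∘ e') where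
  d := (LinearEquiv.funCongrLeft (CoordRing K) (CoordRing K) e).toLinearMap ∘ₗ ρ.d ∘ₗ
    (LinearEquiv.funCongrLeft (CoordRing K) (CoordRing K) e').symm.toLinearMap
  ε := ρ.ε ∘ₗ (LinearEquiv.funCongrLeft (CoordRing K) (CoordRing K) e).symm.toLinearMap
  d_graded n v hv i := by
    refine ρ.d_graded n _ (fun j => ?_) (e i)
    simpa using hv (e'.symm j)
  ε_graded n v hv := by
    refine ρ.ε_graded n _ (fun j => ?_)
    simpa using hv (e.symm j)
  d_injective := by
    simp only [LinearMap.coe_comp, LinearEquiv.coe_coe]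
    exact (LinearEquiv.injective _).comp (ρ.d_injective.comp (LinearEquiv.injective _))
  exact v := by
    rw [LinearMap.comp_apply, ρ.exact]
    constructor
    · rintro ⟨w, hw⟩
      refine ⟨LinearEquiv.funCongrLeft (CoordRing K) (CoordRing K) e' w, ?_⟩
      simp only [LinearMap.comp_apply, LinearEquiv.coe_coe, LinearEquiv.symm_apply_apply] at hw ⊢
      rw [hw, LinearEquiv.apply_symm_apply]
    · rintro ⟨w, rfl⟩
      exact ⟨(LinearEquiv.funCongrLeft (CoordRing K) (CoordRing K) e').symm w, by
        simp only [LinearMap.comp_apply, LinearEquiv.coe_coe, LinearEquiv.symm_apply_apply]⟩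
  ε_surjective := by
    simp only [LinearMap.coe_comp, LinearEquiv.coe_coe]
    exact ρ.ε_surjective.comp (LinearEquiv.surjective _)
  minimal v i := ρ.minimal _ _

theorem hasMinimalFreeResolution [Fintype ι] [Fintype κ] (ρ : MinimalFreeResolution J a b) :
    HasMinimalFreeResolution J (Finset.univ.val.map a) (Finset.univ.val.map b) := by
  refine ⟨_, _, a ∘ (Fintype.equivFin ι).symm, b ∘ (Fintype.equivFin κ).symm, ?_, ?_,
    ⟨ρ.reindex _ _⟩⟩
  · rw [← Multiset.map_map]
    congr 1
    exact congrArg Finset.val (Finset.map_univ_equiv (Fintype.equivFin ι).symm)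
  · rw [← Multiset.map_map]
    congr 1
    exact congrArg Finset.val (Finset.map_univ_equiv (Fintype.equivFin κ).symm)

/-- The resolution `0 → 0 → R → R → 0` of the unit ideal. -/
noncomputable def top : MinimalFreeResolution (⊤ : Ideal (CoordRing K)) (fun _ : Unit => 0)
    (fun j : Empty => j.elim) where
  d := 0
  ε := Submodule.topEquiv.symm.toLinearMap ∘ₗ LinearMap.proj ()
  d_graded n v _ i := zero_mem _
  ε_graded n v hv := by simpa using hv ()
  d_injective := Function.injective_of_subsingleton _
  exact v := by
    constructor
    · intro h
      refine ⟨0, ?_⟩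
      funext i
      exact (congrArg Subtype.val h).symm
    · rintro ⟨w, rfl⟩
      simp
  ε_surjective x := ⟨fun _ => x, rfl⟩
  minimal v i := zero_mem _

/-- The augmentation of the resolution of `q J' + (f i)` obtained from one of `J'`. -/
noncomputable def extendε [Fintype ι'] (ρ : MinimalFreeResolution J' a b) (q : CoordRing K)
    (hqJ : ∀ x ∈ J', q * x ∈ J) (f : ι' → CoordRing K) (hfJ : ∀ i, f i ∈ J) :
    (ι ⊕ ι' → CoordRing K) →ₗ[CoordRing K] J where
  toFun v := ⟨q * ρ.ε (v ∘ Sum.inl) + ∑ i, v (Sum.inr i) * f i,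
    J.add_mem (hqJ _ (ρ.ε _).2) (J.sum_mem fun i _ => J.mul_mem_left _ (hfJ i))⟩
  map_add' v w := by
    have h : (v + w) ∘ (Sum.inl : ι → ι ⊕ ι') = v ∘ Sum.inl + w ∘ Sum.inl := rfl
    apply Subtype.ext
    simp only [h, map_add, Pi.add_apply, add_mul, Finset.sum_add_distrib, Submodule.coe_add]
    ring
  map_smul' r v := by
    have h : (r • v) ∘ (Sum.inl : ι → ι ⊕ ι') = r • (v ∘ Sum.inl) := rfl
    apply Subtype.ext
    simp only [h, map_smul, Pi.smul_apply, smul_eq_mul, mul_assoc, ← Finset.mul_sum,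
      Submodule.coe_smul, RingHom.id_apply]
    ring

theorem extendε_coe [Fintype ι'] (ρ : MinimalFreeResolution J' a b) (q : CoordRing K)
    (hqJ : ∀ x ∈ J', q * x ∈ J) (f : ι' → CoordRing K) (hfJ : ∀ i, f i ∈ J)
    (v : ι ⊕ ι' → CoordRing K) : (ρ.extendε q hqJ f hfJ v : CoordRing K) =
      q * ρ.ε (v ∘ Sum.inl) + ∑ i, v (Sum.inr i) * f i :=
  rfl

variable [Fintype κ'] [DecidableEq ι]

/-- The differential of the resolution of `q J' + (f i)` obtained from one of `J'`. -/
noncomputable def extendD (ρ : MinimalFreeResolution J' a b) (i₀ : ι) (N : κ' → ι' → CoordRing K)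
    (c : κ' → CoordRing K) : (κ ⊕ κ' → CoordRing K) →ₗ[CoordRing K] (ι ⊕ ι' → CoordRing K) where
  toFun v := Sum.elim (ρ.d (v ∘ Sum.inl) - Pi.single i₀ (∑ j, v (Sum.inr j) * c j))
    (fun i => ∑ j, v (Sum.inr j) * N j i)
  map_add' v w := by
    have h : (v + w) ∘ (Sum.inl : κ → κ ⊕ κ') = v ∘ Sum.inl + w ∘ Sum.inl := rfl
    funext x
    rcases x with i | i
    · simp only [Sum.elim_inl, h, map_add, Pi.add_apply, add_mul, Finset.sum_add_distrib,
        Pi.single_add, Pi.sub_apply]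
      ring
    · simp [add_mul, Finset.sum_add_distrib]
  map_smul' r v := by
    have h : (r • v) ∘ (Sum.inl : κ → κ ⊕ κ') = r • (v ∘ Sum.inl) := rfl
    funext x
    rcases x with i | i
    · simp only [Sum.elim_inl, h, map_smul, Pi.smul_apply, smul_eq_mul, mul_assoc,
        ← Finset.mul_sum, Pi.sub_apply, RingHom.id_apply, Pi.single_apply, mul_sub, mul_ite,
        mul_zero]
    · simp [mul_assoc, Finset.mul_sum]

theorem extendD_inl (ρ : MinimalFreeResolution J' a b) (i₀ : ι) (N : κ' → ι' → CoordRing K)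
    (c : κ' → CoordRing K) (v : κ ⊕ κ' → CoordRing K) (i : ι) :
    ρ.extendD i₀ N c v (Sum.inl i) = ρ.d (v ∘ Sum.inl) i -
      (Pi.single i₀ (∑ j, v (Sum.inr j) * c j) : ι → CoordRing K) i :=
  rfl

theorem extendD_comp_inl (ρ : MinimalFreeResolution J' a b) (i₀ : ι) (N : κ' → ι' → CoordRing K)
    (c : κ' → CoordRing K) (v : κ ⊕ κ' → CoordRing K) :
    ρ.extendD i₀ N c v ∘ Sum.inl = ρ.d (v ∘ Sum.inl) -
      Pi.single i₀ (∑ j, v (Sum.inr j) * c j) :=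
  rfl

theorem extendD_inr (ρ : MinimalFreeResolution J' a b) (i₀ : ι) (N : κ' → ι' → CoordRing K)
    (c : κ' → CoordRing K) (v : κ ⊕ κ' → CoordRing K) (i : ι') :
    ρ.extendD i₀ N c v (Sum.inr i) = ∑ j, v (Sum.inr j) * N j i :=
  rfl

/-- The rows of N are a free basis of the relations among the fᵢ modulo q. Each of them lifts to a
relation in J whose q-part is cⱼ times one basis element of the old G₀, so the new columns of the
differential are (-cⱼ e_{i₀}, Nⱼ). A kernel element has its f-part in the span of N; removing that
leaves q times a relation of J', handled by the old exactness. Multiplication by q shifts the old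
twists by e. -/
theorem exists_extend [Fintype ι'] (ρ : MinimalFreeResolution J' a b) (i₀ : ι)
    {q : CoordRing K} {e : ℕ} (hq : q.IsHomogeneous e) (hq0 : q ≠ 0)
    (hqJ : ∀ x ∈ J', q * x ∈ J)
    {f : ι' → CoordRing K} {a' : ι' → ℤ} (hfJ : ∀ i, f i ∈ J) (hf : ∀ i, f i ∈ piece K (-a' i))
    (hgen : ∀ x ∈ J, ∃ y ∈ J', ∃ v : ι' → CoordRing K, x = q * y + ∑ i, v i * f i)
    {N : κ' → ι' → CoordRing K} {c : κ' → CoordRing K} {b' : κ' → ℤ}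
    (hN : ∀ j i, N j i ∈ piece K (a' i - b' j)) (hc : ∀ j, c j ∈ piece K (a i₀ - e - b' j))
    (hNm : ∀ j i, N j i ∈ Ideal.span (Set.range (X : Fin 3 → CoordRing K)))
    (hcm : ∀ j, c j ∈ Ideal.span (Set.range (X : Fin 3 → CoordRing K)))
    (hrel : ∀ j, ∑ i, N j i * f i = q * (c j * ρ.ε (Pi.single i₀ 1)))
    (hsyz : ∀ v : ι' → CoordRing K, q ∣ ∑ i, v i * f i →
      ∃ w : κ' → CoordRing K, ∀ i, v i = ∑ j, w j * N j i)
    (hNinj : ∀ w : κ' → CoordRing K, (∀ i, ∑ j, w j * N j i = 0) → w = 0) :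
    ∃ ρ' : MinimalFreeResolution J (Sum.elim (fun i => a i - e) a')
        (Sum.elim (fun j => b j - e) b'),
      ∀ v, (ρ'.ε v : CoordRing K) = q * ρ.ε (v ∘ Sum.inl) + ∑ i, v (Sum.inr i) * f i := by
  have hsingle : ∀ r : CoordRing K,
      (ρ.ε (Pi.single i₀ r) : CoordRing K) = r * ρ.ε (Pi.single i₀ 1) := by
    intro r
    have : (Pi.single i₀ r : ι → CoordRing K) = r • Pi.single i₀ 1 := by
      rw [← Pi.single_smul, smul_eq_mul, mul_one]
    rw [this, map_smul]
    rfl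
  have hsum : ∀ w : κ' → CoordRing K, ∑ i, (∑ j, w j * N j i) * f i =
      q * ((∑ j, w j * c j) * ρ.ε (Pi.single i₀ 1)) := by
    intro w
    simp only [Finset.sum_mul]
    rw [Finset.sum_comm, Finset.mul_sum]
    refine Finset.sum_congr rfl fun j _ => ?_
    simp only [mul_assoc]
    rw [← Finset.mul_sum, hrel]
    ring
  refine ⟨⟨ρ.extendD i₀ N c, ρ.extendε q hqJ f hfJ, ?_, ?_, ?_, ?_, ?_, ?_⟩, fun _ => rfl⟩
  · rintro n v hv (i | i)
    · refine Submodule.sub_mem _ ?_ ?_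
      · have := ρ.d_graded (n - e) (v ∘ Sum.inl) (fun j => ?_) i
        · simpa [sub_add_eq_add_sub, add_sub_assoc] using this
        · simpa [sub_add_eq_add_sub, add_sub_assoc] using hv (Sum.inl j)
      · by_cases h : i = i₀
        · subst h
          rw [Pi.single_eq_same]
          refine Submodule.sum_mem _ fun j _ => ?_
          convert mul_mem_piece (hv (Sum.inr j)) (hc j) using 2
          simp only [Sum.elim_inl, Sum.elim_inr]
          ring
        · rw [Pi.single_eq_of_ne h]
          exact zero_mem _
    · refine Submodule.sum_mem _ fun j _ => ?_
      convert mul_mem_piece (hv (Sum.inr j)) (hN j i) using 2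
      simp only [Sum.elim_inr]
      ring
  · intro n v hv
    refine Submodule.add_mem _ ?_ (Submodule.sum_mem _ fun i _ => ?_)
    · convert mul_mem_piece (mem_piece_natCast.2 hq)
        (ρ.ε_graded (n - e) (v ∘ Sum.inl) (fun j => ?_)) using 2
      · ring
      · simpa [sub_add_eq_add_sub, add_sub_assoc] using hv (Sum.inl j)
    · convert mul_mem_piece (hv (Sum.inr i)) (hf i) using 2
      simp
  · rw [injective_iff_map_eq_zero]
    intro v hv
    have h2 : v ∘ Sum.inr = 0 := hNinj _ fun i => congrFun hv (Sum.inr i)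
    have h3 : ∀ j, v (Sum.inr j) = 0 := congrFun h2
    have h1 : v ∘ Sum.inl = 0 := by
      apply ρ.d_injective
      rw [map_zero]
      funext i
      have h4 := congrFun hv (Sum.inl i)
      rw [extendD_inl] at h4
      simpa [h3] using h4
    funext x
    rcases x with j | j
    · exact congrFun h1 j
    · exact h3 j
  · intro v
    constructor
    · intro hv
      have hv' : q * ρ.ε (v ∘ Sum.inl) + ∑ i, v (Sum.inr i) * f i = 0 := congrArg Subtype.val hv
      obtain ⟨w, hw⟩ := hsyz (fun i => v (Sum.inr i))
        ⟨-ρ.ε (v ∘ Sum.inl), by linear_combination hv'⟩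
      simp only [hw, hsum] at hv'
      have h0 : ρ.ε (v ∘ Sum.inl + Pi.single i₀ (∑ j, w j * c j)) = 0 := by
        apply Subtype.ext
        rw [map_add, Submodule.coe_add, hsingle]
        apply mul_left_cancel₀ hq0
        rw [Submodule.coe_zero, mul_zero]
        linear_combination hv'
      obtain ⟨u, hu⟩ := (ρ.exact _).1 h0
      refine ⟨Sum.elim u w, ?_⟩
      funext x
      rcases x with i | i
      · rw [extendD_inl, Sum.elim_comp_inl, hu]
        simp only [Sum.elim_inr, Pi.add_apply, Function.comp_apply, add_sub_cancel_right]
      · rw [extendD_inr, hw]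
        simp only [Sum.elim_inr]
    · rintro ⟨w, rfl⟩
      apply Subtype.ext
      rw [extendε_coe, extendD_comp_inl]
      simp only [extendD_inr]
      have h0 : ρ.ε (ρ.d (w ∘ Sum.inl)) = 0 := (ρ.exact _).2 ⟨_, rfl⟩
      rw [map_sub, h0, zero_sub, Submodule.coe_neg, hsingle, hsum, mul_neg, neg_add_cancel,
        Submodule.coe_zero]
  · rintro ⟨x, hx⟩
    obtain ⟨y, hy, v, rfl⟩ := hgen x hx
    obtain ⟨u, hu⟩ := ρ.ε_surjective ⟨y, hy⟩
    refine ⟨Sum.elim u v, Subtype.ext ?_⟩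
    rw [extendε_coe, Sum.elim_comp_inl, hu]
    simp only [Sum.elim_inr]
  · rintro v (i | i)
    · refine Ideal.sub_mem _ (ρ.minimal _ _) ?_
      by_cases h : i = i₀
      · subst h
        rw [Pi.single_eq_same]
        exact Ideal.sum_mem _ fun j _ => Ideal.mul_mem_left _ _ (hcm j)
      · rw [Pi.single_eq_of_ne h]
        exact zero_mem _
    · exact Ideal.sum_mem _ fun j _ => Ideal.mul_mem_left _ _ (hNm j i)

end MinimalFreeResolution

/-- `J` has a minimal free resolution with twists `A` and `B` in which the generator `f` of `J`
is the image of a basis element of twist `c`. -/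
def HasPointedResolution (J : Ideal (CoordRing K)) (A B : Multiset ℤ) (f : CoordRing K) (c : ℤ) :
    Prop :=
  ∃ (ι κ : Type) (_ : Fintype ι) (_ : Fintype κ) (_ : DecidableEq ι) (a : ι → ℤ) (b : κ → ℤ)
    (ρ : MinimalFreeResolution J a b) (i₀ : ι), Finset.univ.val.map a = A ∧
      Finset.univ.val.map b = B ∧ a i₀ = c ∧ (ρ.ε (Pi.single i₀ 1) : CoordRing K) = f

theorem HasPointedResolution.hasMinimalFreeResolution {J : Ideal (CoordRing K)} {A B : Multiset ℤ}
    {f : CoordRing K} {c : ℤ} (h : HasPointedResolution J A B f c) :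
    HasMinimalFreeResolution J A B := by
  obtain ⟨ι, κ, _, _, _, a, b, ρ, i₀, rfl, rfl, -, -⟩ := h
  exact ρ.hasMinimalFreeResolution

theorem hasPointedResolution_top {J : Ideal (CoordRing K)} (hJ : J = ⊤) :
    HasPointedResolution J {0} 0 1 0 := by
  subst hJ
  exact ⟨Unit, Empty, inferInstance, inferInstance, inferInstance, _, _,
    MinimalFreeResolution.top, (), rfl, rfl, rfl, by simp [MinimalFreeResolution.top]⟩

theorem univ_val_map_sumElim {ι ι' β : Type*} [Fintype ι] [Fintype ι'] (a : ι → β) (a' : ι' → β) :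
    (Finset.univ : Finset (ι ⊕ ι')).val.map (Sum.elim a a') =
      Finset.univ.val.map a + Finset.univ.val.map a' := by
  rw [← Finset.univ_disjSum_univ, Finset.val_disjSum, Multiset.disjSum, Multiset.map_add,
    Multiset.map_map, Multiset.map_map]
  rfl

/-- The distinguished element moves to the new generator `f i₁`, which is what makes the
construction iterable. -/
theorem HasPointedResolution.extend {J J' : Ideal (CoordRing K)} {A B : Multiset ℤ}
    {g : CoordRing K} {γ : ℤ} (h : HasPointedResolution J' A B g γ)
    {ι' κ' : Type} [Fintype ι'] [Fintype κ'] [DecidableEq ι'] (i₁ : ι')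
    {q : CoordRing K} {e : ℕ} (hq : q.IsHomogeneous e) (hq0 : q ≠ 0)
    (hqJ : ∀ x ∈ J', q * x ∈ J)
    {f : ι' → CoordRing K} {a' : ι' → ℤ} (hfJ : ∀ i, f i ∈ J) (hf : ∀ i, f i ∈ piece K (-a' i))
    (hgen : ∀ x ∈ J, ∃ y ∈ J', ∃ v : ι' → CoordRing K, x = q * y + ∑ i, v i * f i)
    {N : κ' → ι' → CoordRing K} {c : κ' → CoordRing K} {b' : κ' → ℤ}
    (hN : ∀ j i, N j i ∈ piece K (a' i - b' j)) (hc : ∀ j, c j ∈ piece K (γ - e - b' j))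
    (hNm : ∀ j i, N j i ∈ Ideal.span (Set.range (X : Fin 3 → CoordRing K)))
    (hcm : ∀ j, c j ∈ Ideal.span (Set.range (X : Fin 3 → CoordRing K)))
    (hrel : ∀ j, ∑ i, N j i * f i = q * (c j * g))
    (hsyz : ∀ v : ι' → CoordRing K, q ∣ ∑ i, v i * f i →
      ∃ w : κ' → CoordRing K, ∀ i, v i = ∑ j, w j * N j i)
    (hNinj : ∀ w : κ' → CoordRing K, (∀ i, ∑ j, w j * N j i = 0) → w = 0) :
    HasPointedResolution J (A.map (· - (e : ℤ)) + Finset.univ.val.map a')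
      (B.map (· - (e : ℤ)) + Finset.univ.val.map b') (f i₁) (a' i₁) := by
  obtain ⟨ι, κ, _, _, _, a, b, ρ, i₀, rfl, rfl, rfl, rfl⟩ := h
  obtain ⟨ρ', hρ'⟩ := ρ.exists_extend i₀ hq hq0 hqJ hfJ hf hgen hN hc hNm hcm hrel hsyz hNinj
  refine ⟨ι ⊕ ι', κ ⊕ κ', inferInstance, inferInstance, inferInstance, _, _, ρ', Sum.inr i₁,
    ?_, ?_, rfl, ?_⟩
  · rw [univ_val_map_sumElim, Multiset.map_map]
    rfl
  · rw [univ_val_map_sumElim, Multiset.map_map]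
    rfl
  · have h0 : (Pi.single (Sum.inr i₁) 1 : ι ⊕ ι' → CoordRing K) ∘ Sum.inl = 0 := by
      funext i
      simp
    rw [hρ', h0, map_zero]
    simp [Pi.single_apply]

end Existence

/-! ### Parity in K[s,t] -/

section BinaryForms

variable {K : Type*} [Field K]

/-- The polynomial ring `K[s, t]`. -/
abbrev Binary (K : Type*) [Field K] : Type _ := MvPolynomial (Fin 2) K

/-- All monomials of `p` have a total degree of parity `ε`. -/
def HasParity (p : Binary K) (ε : ZMod 2) : Prop :=
  IsWeightedHomogeneous (fun _ : Fin 2 => (1 : ZMod 2)) p ε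

theorem weight_one_zmod (d : Fin 2 →₀ ℕ) :
    Finsupp.weight (fun _ : Fin 2 => (1 : ZMod 2)) d = ((d 0 + d 1 : ℕ) : ZMod 2) := by
  rw [Finsupp.weight_apply, Finsupp.sum_fintype _ _ (by simp)]
  simp

theorem degree_fin_two (d : Fin 2 →₀ ℕ) : d.degree = d 0 + d 1 := by
  rw [Finsupp.degree_eq_sum, Fin.sum_univ_two]

theorem HasParity.of_isHomogeneous {p : Binary K} {n : ℕ} (hp : p.IsHomogeneous n) :
    HasParity p n := by
  intro d hd
  rw [weight_one_zmod, ← degree_fin_two, Finsupp.degree_eq_weight_one]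
  exact congrArg _ (hp hd)

theorem HasParity.mul {p q : Binary K} {ε δ : ZMod 2} (hp : HasParity p ε) (hq : HasParity q δ) :
    HasParity (p * q) (ε + δ) :=
  IsWeightedHomogeneous.mul hp hq

theorem HasParity.add {p q : Binary K} {ε : ZMod 2} (hp : HasParity p ε) (hq : HasParity q ε) :
    HasParity (p + q) ε :=
  IsWeightedHomogeneous.add hp hq

theorem HasParity.of_mul_left {p q : Binary K} {ε δ : ZMod 2} (hp : HasParity p ε) (hp0 : p ≠ 0)
    (h : HasParity (p * q) δ) : HasParity q (δ - ε) :=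
  isWeightedHomogeneous_of_mul_left hp hp0 h

theorem hasParity_X (i : Fin 2) : HasParity (X i : Binary K) 1 :=
  isWeightedHomogeneous_X _ _ _

/-- An odd polynomial has no constant term, so it lies in (s, t), and the cofactors may be replaced
by their even parts. Thus the odd part is generated by s and t over the even part. -/
theorem HasParity.exists_eq_add {p : Binary K} (hp : HasParity p 1) :
    ∃ p₀ p₁ : Binary K, HasParity p₀ 0 ∧ HasParity p₁ 0 ∧ p = X 0 * p₀ + X 1 * p₁ := by
  have h0 : p ∈ Ideal.span ({X 0, X 1} : Set (Binary K)) := by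
    have : ({X 0, X 1} : Set (Binary K)) = X '' Set.univ := by
      rw [Set.image_univ]
      ext x
      simp [Fin.exists_fin_two, eq_comm]
    rw [this, mem_ideal_span_X_image]
    intro d hd
    have hd0 : d ≠ 0 := by
      rintro rfl
      rw [mem_support_iff] at hd
      have := hp hd
      simp at this
    obtain ⟨i, hi⟩ := Finsupp.ne_iff.1 hd0
    exact ⟨i, trivial, hi⟩
  obtain ⟨q₀, q₁, h⟩ := Ideal.mem_span_pair.1 h0
  refine ⟨weightedHomogeneousComponent (fun _ => (1 : ZMod 2)) 0 q₀,
    weightedHomogeneousComponent (fun _ => (1 : ZMod 2)) 0 q₁,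
    weightedHomogeneousComponent_isWeightedHomogeneous (w := fun _ => 1) 0 q₀,
    weightedHomogeneousComponent_isWeightedHomogeneous (w := fun _ => 1) 0 q₁, ?_⟩
  have h1 := hp.weightedHomogeneousComponent_same
  rw [← h, map_add, mul_comm q₀, mul_comm q₁,
    weightedHomogeneousComponent_mul_of_left (hasParity_X 0),
    weightedHomogeneousComponent_mul_of_left (hasParity_X 1), sub_self] at h1
  rw [h1, ← h, mul_comm q₀, mul_comm q₁]

end BinaryForms

/-! ### Homogeneous vanishing at a point via restriction to its line -/

section LineMap

variable {K : Type*} [Field K] {σ : Type*}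

/-- Restriction of polynomials to the line spanned by `v`: the map `xⱼ ↦ vⱼ T`. -/
noncomputable def lineMap (v : σ → K) : MvPolynomial σ K →ₐ[K] Polynomial K :=
  aeval fun j => Polynomial.C (v j) * Polynomial.X

theorem lineMap_X (v : σ → K) (j : σ) : lineMap v (X j) = Polynomial.C (v j) * Polynomial.X :=
  aeval_X _ _

theorem lineMap_monomial (v : σ → K) (d : σ →₀ ℕ) (c : K) :
    lineMap v (monomial d c) = Polynomial.C (eval v (monomial d c)) * Polynomial.X ^ d.degree := by
  rw [lineMap, aeval_monomial, eval_monomial, Finsupp.prod, Finsupp.prod]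
  simp only [mul_pow, Finset.prod_mul_distrib, Finset.prod_pow_eq_pow_sum, map_mul, map_prod,
    map_pow, Finsupp.degree_apply, Polynomial.algebraMap_eq]
  ring

theorem lineMap_of_isHomogeneous (v : σ → K) {f : MvPolynomial σ K} {n : ℕ}
    (hf : f.IsHomogeneous n) : lineMap v f = Polynomial.C (eval v f) * Polynomial.X ^ n := by
  conv_lhs => rw [f.as_sum]
  conv_rhs => rw [f.as_sum]
  rw [map_sum, map_sum, map_sum, Finset.sum_mul]
  refine Finset.sum_congr rfl fun d hd => ?_
  rw [lineMap_monomial]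
  congr 2
  rw [Finsupp.degree_eq_weight_one]
  exact hf (mem_support_iff.1 hd)

/-- Consequently the kernel of `lineMap v` consists of the polynomials all of whose homogeneous
components vanish at v. -/
theorem coeff_lineMap (v : σ → K) (f : MvPolynomial σ K) (n : ℕ) :
    (lineMap v f).coeff n = eval v (homogeneousComponent n f) := by
  conv_lhs => rw [← sum_homogeneousComponent f]
  rw [map_sum, Polynomial.finsetSum_coeff]
  simp only [lineMap_of_isHomogeneous v (homogeneousComponent_isHomogeneous _ f),
    Polynomial.coeff_C_mul, Polynomial.coeff_X_pow]
  simp only [mul_ite, mul_one, mul_zero]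
  rw [Finset.sum_ite_eq]
  split_ifs with h
  · rfl
  · rw [homogeneousComponent_eq_zero _ _ (by simpa using h), map_zero]

theorem dvd_algHom_sub {A : Type*} [CommRing A] [Algebra K A] (φ ψ : MvPolynomial σ K →ₐ[K] A)
    (u : A) (h : ∀ i, u ∣ φ (X i) - ψ (X i)) (p : MvPolynomial σ K) : u ∣ φ p - ψ p := by
  have h1 : (Ideal.Quotient.mkₐ K (Ideal.span {u})).comp φ =
      (Ideal.Quotient.mkₐ K (Ideal.span {u})).comp ψ := by
    refine algHom_ext fun i => ?_
    simp only [AlgHom.comp_apply, Ideal.Quotient.mkₐ_eq_mk]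
    rw [Ideal.Quotient.mk_eq_mk_iff_sub_mem, Ideal.mem_span_singleton]
    exact h i
  have h2 := AlgHom.congr_fun h1 p
  simp only [AlgHom.comp_apply, Ideal.Quotient.mkₐ_eq_mk] at h2
  rwa [Ideal.Quotient.mk_eq_mk_iff_sub_mem, Ideal.mem_span_singleton] at h2

/-- The linear form in `s, t` vanishing at `w`. -/
noncomputable def rootForm (w : Fin 2 → K) : Binary K := C (w 1) * X 0 - C (w 0) * X 1

theorem rootForm_isHomogeneous (w : Fin 2 → K) : (rootForm w).IsHomogeneous 1 :=
  (isHomogeneous_C_mul_X _ _).sub (isHomogeneous_C_mul_X _ _)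

/-- Dividing by a nonzero coordinate of w yields a linear form c with each variable Xᵢ congruent to
wᵢ c modulo the root form. Hence p is congruent to its restriction evaluated at T = c. -/
theorem lineMap_eq_zero_iff_rootForm_dvd {w : Fin 2 → K} (hw : w ≠ 0) (p : Binary K) :
    lineMap w p = 0 ↔ rootForm w ∣ p := by
  constructor
  · intro hp
    have key : ∀ c : Binary K, (∀ i, rootForm w ∣ X i - C (w i) * c) → rootForm w ∣ p := by
      intro c hc
      have := dvd_algHom_sub (AlgHom.id K (Binary K)) ((Polynomial.aeval c).comp (lineMap w))
        (rootForm w) (fun i => by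
          simpa [lineMap_X, MvPolynomial.algebraMap_eq] using hc i) p
      simpa [hp] using this
    by_cases h1 : w 1 = 0
    · have h0 : w 0 ≠ 0 := fun h0 => hw (by funext i; fin_cases i <;> simp [h0, h1])
      refine key (C (w 0)⁻¹ * X 0) ?_
      rw [Fin.forall_fin_two]
      have e0 : (C (w 0) * C (w 0)⁻¹ : Binary K) = 1 := by rw [← C_mul, mul_inv_cancel₀ h0, C_1]
      constructor
      · rw [← mul_assoc, e0, one_mul, sub_self]
        exact dvd_zero _
      · refine ⟨-C (w 0)⁻¹, ?_⟩
        rw [rootForm]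
        linear_combination (-X 1) * e0
    · refine key (C (w 1)⁻¹ * X 1) ?_
      rw [Fin.forall_fin_two]
      have e0 : (C (w 1) * C (w 1)⁻¹ : Binary K) = 1 := by rw [← C_mul, mul_inv_cancel₀ h1, C_1]
      constructor
      · refine ⟨C (w 1)⁻¹, ?_⟩
        rw [rootForm]
        linear_combination (-X 0) * e0
      · rw [← mul_assoc, e0, one_mul, sub_self]
        exact dvd_zero _
  · rintro ⟨q, rfl⟩
    rw [map_mul, rootForm]
    simp only [map_sub, map_mul, lineMap_X]
    rw [lineMap, ← MvPolynomial.algebraMap_eq, AlgHom.commutes, AlgHom.commutes,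
      Polynomial.algebraMap_eq]
    ring

theorem rootForm_ne_zero {w : Fin 2 → K} (hw : w ≠ 0) : rootForm w ≠ 0 := by
  intro h
  apply hw
  have hc : ∀ i j : Fin 2, coeff (Finsupp.single i 1) (X j : Binary K) = if j = i then 1 else 0 := by
    intro i j
    rw [coeff_X]
    simp [Finsupp.single_left_inj]
  funext i
  fin_cases i
  · have := congrArg (coeff (Finsupp.single 1 1)) h
    simpa [rootForm, coeff_C_mul, hc] using this
  · have := congrArg (coeff (Finsupp.single 0 1)) h
    simpa [rootForm, coeff_C_mul, hc] using this

theorem prime_rootForm {w : Fin 2 → K} (hw : w ≠ 0) : Prime (rootForm w) := by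
  rw [← Ideal.span_singleton_prime (rootForm_ne_zero hw)]
  have : Ideal.span {rootForm w} = RingHom.ker (lineMap w) := by
    ext p
    rw [Ideal.mem_span_singleton, RingHom.mem_ker, lineMap_eq_zero_iff_rootForm_dvd hw]
  rw [this]
  exact RingHom.ker_isPrime _

end LineMap

/-! ### The parametrized conic: kernel and image of the parametrization -/

section Conic

variable {K : Type*} [Field K]

variable (K) in
/-- Linear coordinates on the plane. -/
structure Coordinates where
  /-- the coordinate change -/
  e : CoordRing K ≃ₐ[K] CoordRing K
  /-- coordinates are linear forms -/
  isHomogeneous_e : ∀ i, (e (X i)).IsHomogeneous 1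

namespace Coordinates

variable (c : Coordinates K)

/-- The coordinate functions. -/
noncomputable def l (i : Fin 3) : CoordRing K := c.e (X i)

theorem l_isHomogeneous (i : Fin 3) : (c.l i).IsHomogeneous 1 := c.isHomogeneous_e i

/-- The conic `l₀ l₂ = l₁²`. -/
noncomputable def conic : CoordRing K := c.l 0 * c.l 2 - c.l 1 ^ 2

theorem conic_isHomogeneous : c.conic.IsHomogeneous 2 :=
  ((c.l_isHomogeneous 0).mul (c.l_isHomogeneous 2)).sub ((c.l_isHomogeneous 1).pow 2)

/-- The parametrization `(s² : s t : t²)` of the conic, on coordinate rings. -/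
noncomputable def param : CoordRing K →ₐ[K] Binary K :=
  (aeval ![X 0 ^ 2, X 0 * X 1, X 1 ^ 2]).comp c.e.symm.toAlgHom

theorem param_e (f : CoordRing K) :
    c.param (c.e f) = aeval ![X 0 ^ 2, X 0 * X 1, X 1 ^ 2] f := by
  simp [param]

theorem param_l (i : Fin 3) :
    c.param (c.l i) = (![X 0 ^ 2, X 0 * X 1, X 1 ^ 2] : Fin 3 → Binary K) i := by
  rw [l, param_e, aeval_X]

theorem param_l_zero : c.param (c.l 0) = X 0 ^ 2 := c.param_l 0

theorem param_l_one : c.param (c.l 1) = X 0 * X 1 := c.param_l 1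

theorem param_l_two : c.param (c.l 2) = X 1 ^ 2 := c.param_l 2

theorem param_conic : c.param c.conic = 0 := by
  rw [conic, map_sub, map_mul, map_pow, param_l_zero, param_l_one, param_l_two]
  ring

theorem induction_coordinates {P : CoordRing K → Prop} (hC : ∀ k, P (C k))
    (hadd : ∀ f g, P f → P g → P (f + g)) (hmul : ∀ f i, P f → P (f * c.l i)) (f : CoordRing K) :
    P f := by
  obtain ⟨g, rfl⟩ := c.e.surjective f
  induction g using MvPolynomial.induction_on with
  | C k =>
    rw [← MvPolynomial.algebraMap_eq, AlgEquiv.commutes]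
    exact hC k
  | add p q hp hq =>
    rw [map_add]
    exact hadd _ _ hp hq
  | mul_X p i hp =>
    rw [map_mul]
    exact hmul _ _ hp

theorem param_hasParity (f : CoordRing K) : HasParity (c.param f) 0 := by
  induction f using c.induction_coordinates with
  | hC k =>
    rw [← MvPolynomial.algebraMap_eq, AlgHom.commutes, MvPolynomial.algebraMap_eq]
    exact isWeightedHomogeneous_C _ _
  | hadd f g hf hg =>
    rw [map_add]
    exact hf.add hg
  | hmul f i hf =>
    rw [map_mul, param_l]
    refine hf.mul (δ := 0) ?_
    have h2 : ∀ i j : Fin 2, HasParity (X i * X j : Binary K) 0 := fun i j =>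
      (hasParity_X i).mul (hasParity_X j)
    fin_cases i
    · simpa [sq] using h2 0 0
    · simpa using h2 0 1
    · simpa [sq] using h2 1 1

/-- A linear section of the parametrization over the forms of even degree. -/
noncomputable def lift : Binary K →ₗ[K] CoordRing K :=
  (basisMonomials (Fin 2) K).constr K fun d =>
    c.l 0 ^ (d 0 / 2) * c.l 2 ^ (d 1 / 2) * c.l 1 ^ (d 0 % 2)

theorem lift_monomial (d : Fin 2 →₀ ℕ) (k : K) : c.lift (monomial d k) =
    C k * (c.l 0 ^ (d 0 / 2) * c.l 2 ^ (d 1 / 2) * c.l 1 ^ (d 0 % 2)) := by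
  have h : (monomial d k : Binary K) = k • basisMonomials (Fin 2) K d := by
    rw [coe_basisMonomials, smul_monomial, smul_eq_mul, mul_one]
  rw [h, map_smul, lift, Module.Basis.constr_basis, smul_eq_C_mul]

theorem monomial_fin_two (d : Fin 2 →₀ ℕ) (k : K) :
    (monomial d k : Binary K) = C k * (X 0 ^ d 0 * X 1 ^ d 1) := by
  rw [monomial_eq, Finsupp.prod_fintype _ _ (by simp), Fin.prod_univ_two]

/-- In a monomial of even degree both exponents have the same parity, so it is a product of powers
of s² and t² with at most one factor st. -/
theorem param_lift {p : Binary K} (hp : HasParity p 0) : c.param (c.lift p) = p := by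
  conv_lhs => rw [p.as_sum]
  conv_rhs => rw [p.as_sum]
  rw [map_sum, map_sum]
  refine Finset.sum_congr rfl fun d hd => ?_
  have hpar := hp (mem_support_iff.1 hd)
  rw [weight_one_zmod, ZMod.natCast_eq_zero_iff] at hpar
  rw [lift_monomial, monomial_fin_two, map_mul, ← MvPolynomial.algebraMap_eq, AlgHom.commutes,
    ← MvPolynomial.algebraMap_eq]
  simp only [map_mul, map_pow, param_l_zero, param_l_one, param_l_two]
  have e0 : d 0 = 2 * (d 0 / 2) + d 0 % 2 := by omega
  have e1 : d 1 = 2 * (d 1 / 2) + d 0 % 2 := by omega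
  conv_rhs => rw [e0, e1]
  rw [MvPolynomial.algebraMap_eq]
  ring

theorem lift_isHomogeneous {p : Binary K} {n : ℕ} (hp : p.IsHomogeneous (2 * n)) :
    (c.lift p).IsHomogeneous n := by
  rw [p.as_sum, map_sum]
  refine IsHomogeneous.sum _ _ _ fun d hd => ?_
  have hdeg := hp (mem_support_iff.1 hd)
  rw [Pi.one_def, ← Finsupp.degree_eq_weight_one, degree_fin_two] at hdeg
  rw [lift_monomial]
  have := (((c.l_isHomogeneous 0).pow (d 0 / 2)).mul ((c.l_isHomogeneous 2).pow (d 1 / 2))).mul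
    ((c.l_isHomogeneous 1).pow (d 0 % 2))
  convert this.C_mul (coeff d p) using 1
  omega

/-- Modulo the conic, l₁² may be replaced by l₀l₂, which brings every monomial to the normal form
with l₁-exponent at most 1; this is the form that `lift` selects. It follows that the conic
generates the kernel of `param`. -/
theorem conic_dvd_sub_lift_param (f : CoordRing K) : c.conic ∣ f - c.lift (c.param f) := by
  obtain ⟨g, rfl⟩ := c.e.surjective f
  rw [param_e]
  induction g using MvPolynomial.induction_on' with
  | monomial d k =>
    have h1 : c.e (monomial d k) = C k * (c.l 0 ^ d 0 * c.l 1 ^ d 1 * c.l 2 ^ d 2) := by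
      rw [monomial_eq, Finsupp.prod_fintype _ _ (by simp), Fin.prod_univ_three, map_mul,
        ← MvPolynomial.algebraMap_eq, AlgEquiv.commutes]
      simp [l]
    have h2 : aeval ![X 0 ^ 2, X 0 * X 1, X 1 ^ 2] (monomial d k) =
        (monomial (Finsupp.single 0 (2 * d 0 + d 1) + Finsupp.single 1 (d 1 + 2 * d 2)) k :
          Binary K) := by
      rw [aeval_monomial, monomial_fin_two, Finsupp.prod_fintype _ _ (by simp),
        Fin.prod_univ_three]
      simp only [MvPolynomial.algebraMap_eq, Matrix.cons_val_zero, Matrix.cons_val_one,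
        Matrix.cons_val, Finsupp.add_apply, Finsupp.single_eq_same, Finsupp.single_apply]
      simp
      ring_nf
      simp
    rw [h1, h2, lift_monomial]
    have h3 : c.conic ∣ (c.l 0 * c.l 2) ^ (d 1 / 2) - (c.l 1 ^ 2) ^ (d 1 / 2) :=
      sub_dvd_pow_sub_pow _ _ _
    obtain ⟨x, hx⟩ := h3
    refine ⟨-(C k * c.l 0 ^ d 0 * c.l 2 ^ d 2 * c.l 1 ^ (d 1 % 2)) * x, ?_⟩
    have e1 : ((Finsupp.single 0 (2 * d 0 + d 1) + Finsupp.single 1 (d 1 + 2 * d 2) :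
        Fin 2 →₀ ℕ) 0) = 2 * d 0 + d 1 := by simp
    have e2 : ((Finsupp.single 0 (2 * d 0 + d 1) + Finsupp.single 1 (d 1 + 2 * d 2) :
        Fin 2 →₀ ℕ) 1) = d 1 + 2 * d 2 := by simp
    rw [e1, e2, show (2 * d 0 + d 1) / 2 = d 0 + d 1 / 2 by omega,
      show (d 1 + 2 * d 2) / 2 = d 2 + d 1 / 2 by omega,
      show (2 * d 0 + d 1) % 2 = d 1 % 2 by omega]
    have e3 : c.l 1 ^ d 1 = (c.l 1 ^ 2) ^ (d 1 / 2) * c.l 1 ^ (d 1 % 2) := by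
      rw [← pow_mul, ← pow_add]
      congr 1
      omega
    rw [e3, pow_add, pow_add]
    rw [mul_pow] at hx
    linear_combination -(C k * c.l 0 ^ d 0 * c.l 2 ^ d 2 * c.l 1 ^ (d 1 % 2)) * hx
  | add p q hp hq =>
    simp only [map_add]
    convert dvd_add hp hq using 1
    ring

theorem param_eq_zero_iff (f : CoordRing K) : c.param f = 0 ↔ c.conic ∣ f := by
  constructor
  · intro h
    simpa [h] using c.conic_dvd_sub_lift_param f
  · rintro ⟨g, rfl⟩
    rw [map_mul, param_conic, zero_mul]

theorem conic_dvd_sub_iff (f g : CoordRing K) : c.conic ∣ f - g ↔ c.param f = c.param g := by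
  rw [← param_eq_zero_iff, map_sub, sub_eq_zero]

theorem conic_ne_zero : c.conic ≠ 0 := by
  intro h
  have h2 : (X 0 * X 2 - X 1 ^ 2 : CoordRing K) = 0 := by
    apply c.e.injective
    rw [map_zero, ← h]
    simp [conic, l]
  have h3 := congrArg (eval ![1, 0, 1]) h2
  simp at h3

theorem prime_conic : Prime c.conic := by
  rw [← Ideal.span_singleton_prime c.conic_ne_zero]
  have : Ideal.span {c.conic} = RingHom.ker c.param := by
    ext p
    rw [Ideal.mem_span_singleton, RingHom.mem_ker, param_eq_zero_iff]
  rw [this]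
  exact RingHom.ker_isPrime _

/-- Substituting (s, t) = (w₀T, w₁T) into (s², st, t²) gives the coordinates of v times T², whence
the expansion by 2. -/
theorem lineMap_param {v : Fin 3 → K} {w : Fin 2 → K} (h0 : eval v (c.l 0) = w 0 ^ 2)
    (h1 : eval v (c.l 1) = w 0 * w 1) (h2 : eval v (c.l 2) = w 1 ^ 2) (f : CoordRing K) :
    lineMap w (c.param f) = Polynomial.expand K 2 (lineMap v f) := by
  obtain ⟨g, rfl⟩ := c.e.surjective f
  have h : ((lineMap w).comp c.param).comp c.e.toAlgHom =
      ((Polynomial.expand K 2).comp (lineMap v)).comp c.e.toAlgHom := by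
    refine algHom_ext fun i => ?_
    have hl : ∀ i, c.e (X i) = c.l i := fun i => rfl
    change lineMap w (c.param (c.e (X i))) = Polynomial.expand K 2 (lineMap v (c.e (X i)))
    rw [hl, param_l]
    rw [lineMap_of_isHomogeneous v (c.l_isHomogeneous i)]
    fin_cases i <;> simp [lineMap_X, h0, h1, h2] <;> ring
  exact AlgHom.congr_fun h g

theorem lineMap_eq_zero_iff_dvd_param {v : Fin 3 → K} {w : Fin 2 → K} (hw : w ≠ 0)
    (h0 : eval v (c.l 0) = w 0 ^ 2) (h1 : eval v (c.l 1) = w 0 * w 1)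
    (h2 : eval v (c.l 2) = w 1 ^ 2) (f : CoordRing K) :
    lineMap v f = 0 ↔ rootForm w ∣ c.param f := by
  rw [← lineMap_eq_zero_iff_rootForm_dvd hw, c.lineMap_param h0 h1 h2,
    Polynomial.expand_eq_zero (by norm_num)]

end Coordinates

end Conic

/-! ### Normal form of an irreducible conic with two rational points -/

section NormalForm

variable {K : Type*} [Field K]

/-- The linear substitution `xᵢ ↦ ∑ⱼ Aᵢⱼ xⱼ`. -/
noncomputable def linSubst (A : Matrix (Fin 3) (Fin 3) K) : CoordRing K →ₐ[K] CoordRing K :=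
  aeval fun i => ∑ j, C (A i j) * X j

theorem linSubst_X (A : Matrix (Fin 3) (Fin 3) K) (i : Fin 3) :
    linSubst A (X i) = ∑ j, C (A i j) * X j :=
  aeval_X _ _

theorem linSubst_C (A : Matrix (Fin 3) (Fin 3) K) (k : K) : linSubst A (C k) = C k := by
  rw [← MvPolynomial.algebraMap_eq, AlgHom.commutes]

theorem linSubst_X_isHomogeneous (A : Matrix (Fin 3) (Fin 3) K) (i : Fin 3) :
    (∑ j, C (A i j) * X j : CoordRing K).IsHomogeneous 1 :=
  IsHomogeneous.sum _ _ _ fun _ _ => isHomogeneous_C_mul_X _ _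

theorem linSubst_isHomogeneous (A : Matrix (Fin 3) (Fin 3) K) {f : CoordRing K} {n : ℕ}
    (hf : f.IsHomogeneous n) : (linSubst A f).IsHomogeneous n := by
  have := hf.aeval (fun i => ∑ j, C (A i j) * X j) (linSubst_X_isHomogeneous A)
  rwa [one_mul] at this

theorem linSubst_comp (A B : Matrix (Fin 3) (Fin 3) K) :
    (linSubst A).comp (linSubst B) = linSubst (B * A) := by
  refine algHom_ext fun i => ?_
  rw [AlgHom.comp_apply, linSubst_X, linSubst_X, map_sum]
  simp only [map_mul, linSubst_C, linSubst_X, Finset.mul_sum, Matrix.mul_apply, map_sum,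
    Finset.sum_mul]
  rw [Finset.sum_comm]
  simp only [mul_assoc]

theorem linSubst_one : linSubst (1 : Matrix (Fin 3) (Fin 3) K) = AlgHom.id K _ := by
  refine algHom_ext fun i => ?_
  rw [linSubst_X]
  simp [Matrix.one_apply, apply_ite C]

/-- The linear substitution attached to an invertible matrix. -/
noncomputable def linSubstEquiv (A : Matrix (Fin 3) (Fin 3) K) (hA : IsUnit A.det) :
    CoordRing K ≃ₐ[K] CoordRing K :=
  AlgEquiv.ofAlgHom (linSubst A) (linSubst A⁻¹)
    (by rw [linSubst_comp, Matrix.nonsing_inv_mul _ hA, linSubst_one])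
    (by rw [linSubst_comp, Matrix.mul_nonsing_inv _ hA, linSubst_one])

theorem linSubstEquiv_apply (A : Matrix (Fin 3) (Fin 3) K) (hA : IsUnit A.det) (f : CoordRing K) :
    linSubstEquiv A hA f = linSubst A f :=
  rfl

theorem eval_linSubst (A : Matrix (Fin 3) (Fin 3) K) (v : Fin 3 → K) (f : CoordRing K) :
    eval v (linSubst A f) = eval (A.mulVec v) f := by
  induction f using MvPolynomial.induction_on with
  | C k => rw [linSubst_C, eval_C, eval_C]
  | add p q hp hq => rw [map_add, map_add, map_add, hp, hq]
  | mul_X p i hp =>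
    rw [map_mul, map_mul, map_mul, hp, linSubst_X, eval_X]
    simp [Matrix.mulVec, dotProduct]

open scoped Pointwise in
theorem exists_eq_sum_of_isHomogeneous_two {f : CoordRing K} (hf : f.IsHomogeneous 2) :
    ∃ q : Fin 3 → Fin 3 → K, f = ∑ i, ∑ j, C (q i j) * (X i * X j) := by
  have h : f ∈ Submodule.span K (Set.range (X : Fin 3 → CoordRing K) *
      Set.range (X : Fin 3 → CoordRing K)) := by
    rw [← Submodule.span_mul_span, ← homogeneousSubmodule_one_eq_span_X, ← sq,
      homogeneousSubmodule_one_pow]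
    exact hf
  clear hf
  induction h using Submodule.span_induction with
  | mem x hx =>
    obtain ⟨_, ⟨i, rfl⟩, _, ⟨j, rfl⟩, rfl⟩ := hx
    refine ⟨fun i' j' => if i' = i then if j' = j then 1 else 0 else 0, ?_⟩
    simp [apply_ite C]
  | zero => exact ⟨0, by simp⟩
  | add x y _ _ hx hy =>
    obtain ⟨p, rfl⟩ := hx
    obtain ⟨q, rfl⟩ := hy
    exact ⟨p + q, by simp [add_mul, Finset.sum_add_distrib]⟩
  | smul k x _ hx =>
    obtain ⟨q, rfl⟩ := hx
    exact ⟨k • q, by simp [smul_eq_C_mul, Finset.mul_sum, mul_assoc]⟩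

theorem not_irreducible_mul {f g : CoordRing K} (hf : constantCoeff f = 0)
    (hg : constantCoeff g = 0) : ¬ Irreducible (f * g) := by
  intro h
  rcases h.isUnit_or_isUnit rfl with hu | hu
  · have := hu.map (constantCoeff (σ := Fin 3) (R := K))
    rw [hf] at this
    exact not_isUnit_zero this
  · have := hu.map (constantCoeff (σ := Fin 3) (R := K))
    rw [hg] at this
    exact not_isUnit_zero this

/-- Vanishing at two coordinate points removes x₀² and x₁², leaving coefficients a, b, c, d of x₀x₁,
x₀x₂, x₁x₂, x₂². Then aQ = (ax₀ + cx₂)(ax₁ + bx₂) - (bc - ad)x₂². If a = 0 then x₂ divides Q, and if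
bc = ad then Q splits; both contradict irreducibility. No assumption on the characteristic enters.
-/
theorem exists_matrix_conic {Q : CoordRing K} (hQ : Q.IsHomogeneous 2) (hirr : Irreducible Q)
    (h0 : eval (Pi.single 0 1) Q = 0) (h1 : eval (Pi.single 1 1) Q = 0) :
    ∃ (A : Matrix (Fin 3) (Fin 3) K) (k : K), IsUnit A.det ∧ k ≠ 0 ∧
      Q = C k * linSubst A (X 0 * X 2 - X 1 ^ 2) := by
  obtain ⟨q, hq⟩ := exists_eq_sum_of_isHomogeneous_two hQ
  simp only [Fin.sum_univ_three] at hq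
  rw [hq] at h0 h1
  simp at h0 h1
  set a := q 0 1 + q 1 0
  set b := q 0 2 + q 2 0
  set c := q 1 2 + q 2 1
  set d := q 2 2
  have hQ' : Q = C a * (X 0 * X 1) + C b * (X 0 * X 2) + C c * (X 1 * X 2) + C d * X 2 ^ 2 := by
    rw [hq, h0, h1]
    simp only [a, b, c, d, C_add, C_0]
    ring
  have ha : a ≠ 0 := by
    intro ha
    refine not_irreducible_mul (f := X 2) (g := C b * X 0 + C c * X 1 + C d * X 2)
      (by simp) (by simp) ?_
    convert hirr using 1
    rw [hQ', ha, C_0]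
    ring
  have hai : (C a * C a⁻¹ : CoordRing K) = 1 := by rw [← C_mul, mul_inv_cancel₀ ha, C_1]
  set k := b * c - a * d
  have hk : k ≠ 0 := by
    intro hk
    have hk' : (C b * C c - C a * C d : CoordRing K) = 0 := by
      rw [← C_mul, ← C_mul, ← C_sub]
      exact (congrArg C hk).trans C_0
    refine not_irreducible_mul (f := X 0 + C (a⁻¹ * c) * X 2) (g := C a * X 1 + C b * X 2)
      (by simp) (by simp) ?_
    convert hirr using 1
    rw [hQ', C_mul]
    linear_combination (C c * X 1 * X 2 + C d * X 2 ^ 2) * hai + C a⁻¹ * X 2 ^ 2 * hk'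
  have hki : (C k * C k⁻¹ : CoordRing K) = 1 := by rw [← C_mul, mul_inv_cancel₀ hk, C_1]
  refine ⟨!![k⁻¹ * a, 0, k⁻¹ * c; 0, 0, 1; 0, a, b], a⁻¹ * k, ?_, ?_, ?_⟩
  · rw [Matrix.det_fin_three, isUnit_iff_ne_zero]
    simp [ha, hk]
  · exact mul_ne_zero (inv_ne_zero ha) hk
  · have hkC : (C k : CoordRing K) = C b * C c - C a * C d := by
      rw [← C_mul, ← C_mul, ← C_sub]
    have hl : linSubst !![k⁻¹ * a, 0, k⁻¹ * c; 0, 0, 1; 0, a, b]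
        (X 0 * X 2 - X 1 ^ 2 : CoordRing K) =
        (C k⁻¹ * C a * X 0 + C k⁻¹ * C c * X 2) * (C a * X 1 + C b * X 2) - X 2 ^ 2 := by
      simp [linSubst_X, Fin.sum_univ_three]
    rw [hQ', hl, C_mul]
    linear_combination (-C a⁻¹ * (C a * X 0 + C c * X 2) * (C a * X 1 + C b * X 2)) * hki +
      C a⁻¹ * X 2 ^ 2 * hkC - (C a * (X 0 * X 1) + C b * (X 0 * X 2) + C c * (X 1 * X 2) +
        C d * X 2 ^ 2) * hai

theorem exists_coordinates {Q : CoordRing K} (hQ : Q.IsHomogeneous 2) (hirr : Irreducible Q)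
    {p q : Plane K} (hpq : p ≠ q) (hp : VanishesAt Q p) (hq : VanishesAt Q q) :
    ∃ (c : Coordinates K) (k : K), k ≠ 0 ∧ Q = C k * c.conic := by
  have hli := (Projectivization.independent_pair_iff_ne p q).2 hpq
  rw [Projectivization.independent_iff] at hli
  obtain ⟨x, hx⟩ := exists_linearIndependent_snoc_of_lt_finrank hli (by simp)
  -- The columns are representatives of p and q and a third vector completing them to a basis.
  set V : Matrix (Fin 3) (Fin 3) K := (Matrix.of (Fin.snoc (α := fun _ => Fin 3 → K)
    (Projectivization.rep ∘ ![p, q]) x)).transpose with hV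
  have hdet : IsUnit V.det := by
    rw [hV, Matrix.det_transpose, ← Matrix.isUnit_iff_isUnit_det,
      ← Matrix.linearIndependent_rows_iff_isUnit]
    exact hx
  have hV0 : V.mulVec (Pi.single 0 1) = p.rep := by
    rw [Matrix.mulVec_single_one]
    rfl
  have hV1 : V.mulVec (Pi.single 1 1) = q.rep := by
    rw [Matrix.mulVec_single_one]
    rfl
  obtain ⟨A, k, hA, hk, h⟩ := exists_matrix_conic (Q := linSubst V Q)
    (linSubst_isHomogeneous V hQ)
    ((MulEquiv.irreducible_iff (linSubstEquiv V hdet)).2 hirr)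
    (by rw [eval_linSubst, hV0]; exact hp _ p.rep_nonzero p.mk_rep)
    (by rw [eval_linSubst, hV1]; exact hq _ q.rep_nonzero q.mk_rep)
  refine ⟨⟨(linSubstEquiv A hA).trans (linSubstEquiv V hdet).symm, fun i => ?_⟩, k, hk, ?_⟩
  · change (linSubst V⁻¹ (linSubst A (X i))).IsHomogeneous 1
    exact linSubst_isHomogeneous _ (linSubst_isHomogeneous _ (isHomogeneous_X _ _))
  · apply (linSubstEquiv V hdet).injective
    rw [linSubstEquiv_apply, h, map_mul, linSubstEquiv_apply V hdet (C k), linSubst_C]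
    simp only [Coordinates.conic, Coordinates.l, AlgEquiv.trans_apply, map_sub, map_mul, map_pow,
      AlgEquiv.apply_symm_apply, linSubstEquiv_apply]

end NormalForm

/-! ### Symbolic powers of a finite intersection of incomparable primes -/

section SymbolicPower

variable {A : Type*} [CommRing A]

theorem exists_notMem_forall_mem {ι : Type*} {s : Finset ι} {P : ι → Ideal A} {i : ι}
    (hi : (P i).IsPrime) (hP : ∀ j ∈ s, j ≠ i → ¬ P j ≤ P i) :
    ∃ x ∉ P i, ∀ j ∈ s, j ≠ i → x ∈ P j := by
  classical
  have h : ¬ (s.erase i).inf P ≤ P i := by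
    rw [hi.inf_le']
    rintro ⟨j, hj, hle⟩
    exact hP j (Finset.mem_of_mem_erase hj) (Finset.ne_of_mem_erase hj) hle
  obtain ⟨x, hx, hxi⟩ := SetLike.not_le_iff_exists.1 h
  refine ⟨x, hxi, fun j hj hji => ?_⟩
  exact (Finset.inf_le (f := P) (Finset.mem_erase.2 ⟨hji, hj⟩)) hx

/-- The annihilator of x is the intersection of the Pᵢ not containing x. If it is prime it equals
one of them, and an x lying in all the others but not in Pᵢ isolates Pᵢ. -/
theorem mem_associatedPrimes_inf_iff {ι : Type*} {s : Finset ι} {P : ι → Ideal A}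
    (hprime : ∀ i ∈ s, (P i).IsPrime) (hP : ∀ i ∈ s, ∀ j ∈ s, j ≠ i → ¬ P j ≤ P i)
    (p : Ideal A) : p ∈ associatedPrimes A (A ⧸ s.inf P) ↔ ∃ i ∈ s, p = P i := by
  have hrad : ∀ x : A, (⊥ : Submodule A (A ⧸ s.inf P)).colon {Ideal.Quotient.mk _ x} =
      ((s.inf P).colon {x}) := by
    intro x
    ext y
    rw [Submodule.mem_colon_singleton, Submodule.mem_colon_singleton, Submodule.mem_bot,
      smul_eq_mul, ← Ideal.Quotient.eq_zero_iff_mem, map_mul]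
    rfl
  have hcolon : ∀ x y : A, y ∈ ((s.inf P).colon {x}).radical ↔ ∀ i ∈ s, x ∉ P i → y ∈ P i := by
    intro x y
    rw [Ideal.mem_radical_iff]
    constructor
    · rintro ⟨n, hn⟩ i hi hx
      rw [Submodule.mem_colon_singleton, smul_eq_mul] at hn
      have := hprime i hi
      exact this.mem_of_pow_mem n ((this.mem_or_mem (Finset.inf_le (f := P) hi hn)).resolve_right hx)
    · intro h
      refine ⟨1, ?_⟩
      rw [Submodule.mem_colon_singleton, smul_eq_mul, pow_one, Submodule.mem_finsetInf]
      intro i hi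
      by_cases hx : x ∈ P i
      · exact Ideal.mul_mem_left _ _ hx
      · exact Ideal.mul_mem_right _ _ (h i hi hx)
  constructor
  · rintro ⟨hp, x, hx⟩
    obtain ⟨x, rfl⟩ := Ideal.Quotient.mk_surjective x
    rw [hrad] at hx
    classical
    have hle : (s.filter fun i => x ∉ P i).inf P ≤ p := by
      intro y hy
      rw [hx, hcolon]
      intro i hi hxi
      exact Finset.inf_le (f := P) (Finset.mem_filter.2 ⟨hi, hxi⟩) hy
    obtain ⟨i, hi, hip⟩ := hp.inf_le'.1 hle
    rw [Finset.mem_filter] at hi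
    refine ⟨i, hi.1, le_antisymm (fun y hy => ?_) hip⟩
    rw [hx, hcolon] at hy
    exact hy i hi.1 hi.2
  · rintro ⟨i, hi, rfl⟩
    obtain ⟨x, hx, hxj⟩ := exists_notMem_forall_mem (hprime i hi) (hP i hi)
    refine ⟨hprime i hi, Ideal.Quotient.mk _ x, ?_⟩
    rw [hrad]
    ext y
    rw [hcolon]
    constructor
    · intro hy j hj hxj'
      by_cases hji : j = i
      · rwa [hji]
      · exact absurd (hxj j hj hji) hxj'
    · intro hy
      exact hy i hi hx

/-- An element y outside Pᵢ and inside the other primes satisfies y Pᵢ ⊆ ⋂ Pⱼ, so the intersection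
and Pᵢ agree after localizing at Pᵢ; y^m transports m-th powers. -/
theorem mem_symbolicPower_iff {ι : Type*} {s : Finset ι} {P : ι → Ideal A}
    (hprime : ∀ i ∈ s, (P i).IsPrime) (hP : ∀ i ∈ s, ∀ j ∈ s, j ≠ i → ¬ P j ≤ P i)
    (m : ℕ) (f : A) : f ∈ symbolicPower (s.inf P) m ↔ ∀ i ∈ s, ∃ h ∉ P i, h * f ∈ P i ^ m := by
  rw [symbolicPower, Ideal.mem_iInf]
  have key : ∀ (p : Ideal A) [p.IsPrime],
      f ∈ ((s.inf P ^ m).map (algebraMap A (Localization.AtPrime p))).comap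
        (algebraMap A (Localization.AtPrime p)) ↔ ∃ h ∉ p, h * f ∈ s.inf P ^ m := by
    intro p _
    rw [Ideal.mem_comap, IsLocalization.algebraMap_mem_map_algebraMap_iff p.primeCompl]
    rfl
  constructor
  · intro h i hi
    have := hprime i hi
    have := h ⟨P i, (mem_associatedPrimes_inf_iff hprime hP _).2 ⟨i, hi, rfl⟩⟩
    obtain ⟨x, hx, hxf⟩ := (key (P i)).1 this
    exact ⟨x, hx, Ideal.pow_right_mono (Finset.inf_le hi) m hxf⟩
  · rintro h ⟨p, hp⟩
    obtain ⟨i, hi, rfl⟩ := (mem_associatedPrimes_inf_iff hprime hP _).1 hp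
    have := hprime i hi
    refine (key _).2 ?_
    obtain ⟨x, hx, hxf⟩ := h i hi
    obtain ⟨y, hy, hyj⟩ := exists_notMem_forall_mem (hprime i hi) (hP i hi)
    refine ⟨y ^ m * x, fun h => ?_, ?_⟩
    · rcases this.mem_or_mem h with h | h
      · exact hy (this.mem_of_pow_mem _ h)
      · exact hx h
    · have hle : Ideal.span {y} * P i ≤ s.inf P := by
        refine Finset.le_inf fun j hj => ?_
        by_cases hji : j = i
        · subst hji
          exact Ideal.mul_le_right
        · refine Ideal.mul_le_left.trans ?_
          rw [Ideal.span_singleton_le_iff_mem]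
          exact hyj j hj hji
      refine Ideal.pow_right_mono hle m ?_
      rw [mul_pow, Ideal.span_singleton_pow, mul_assoc]
      exact Ideal.mul_mem_mul (Ideal.mem_span_singleton_self _) hxf

end SymbolicPower

/-! ### Dividing by q in powers of (q, a) -/

section SymbolicStep

variable {A : Type*} [CommRing A]

theorem span_pair_pow_succ_le (q a : A) (n : ℕ) : Ideal.span {q, a} ^ (n + 1) ≤
    Ideal.span {q} * Ideal.span {q, a} ^ n ⊔ Ideal.span {a ^ (n + 1)} := by
  induction n with
  | zero => simp [Ideal.span_insert]
  | succ n ih =>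
    rw [pow_succ']
    nth_rewrite 1 [Ideal.span_insert]
    rw [Ideal.sup_mul]
    refine sup_le le_sup_left ?_
    refine (Ideal.mul_mono_right ih).trans ?_
    rw [Ideal.mul_sup, Ideal.span_singleton_mul_span_singleton, ← pow_succ']
    refine sup_le_sup_right ?_ _
    rw [mul_left_comm]
    refine Ideal.mul_mono_right ?_
    rw [pow_succ']
    exact Ideal.mul_mono_left (Ideal.span_mono (by simp))

/-- Modulo q times the n-th power, an element of the (n+1)-st power is some b a^(n+1). As q is prime
and does not divide a, it divides b and can be cancelled. -/
theorem mem_span_pair_pow_of_mul_mem [IsDomain A] {q a y : A} {n : ℕ} (hq : Prime q)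
    (ha : ¬ q ∣ a) (h : q * y ∈ Ideal.span {q, a} ^ (n + 1)) : y ∈ Ideal.span {q, a} ^ n := by
  obtain ⟨x, hx, z, hz, hxz⟩ := Submodule.mem_sup.1 (span_pair_pow_succ_le q a n h)
  obtain ⟨y', hy', rfl⟩ := Ideal.mem_span_singleton_mul.1 hx
  obtain ⟨b, rfl⟩ := Ideal.mem_span_singleton'.1 hz
  have hdvd : q ∣ b * a ^ (n + 1) := ⟨y - y', by linear_combination hxz⟩
  obtain ⟨b', rfl⟩ := (hq.dvd_or_dvd hdvd).resolve_right fun h => ha (hq.dvd_of_dvd_pow h)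
  have : y = y' + b' * a ^ (n + 1) := by
    apply mul_left_cancel₀ hq.ne_zero
    linear_combination -hxz
  rw [this]
  refine Ideal.add_mem _ hy' (Ideal.mul_mem_left _ _ ?_)
  rw [pow_succ']
  exact Ideal.mul_mem_left _ _ (Ideal.pow_mem_pow (Ideal.subset_span (by simp)) n)

end SymbolicStep

/-! ### Symbolic powers of points on the conic -/

variable {K : Type*} [Field K]

variable (K) in
/-- A sequence of points `(s² : s t : t²)` on a conic, of which the first `r` are distinct. -/
structure ConicPoints (r : ℕ) where
  /-- coordinates in which the conic is `l₀ l₂ = l₁²` -/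
  c : Coordinates K
  /-- the points -/
  v : ℕ → Fin 3 → K
  /-- the parameters of the points -/
  w : ℕ → Fin 2 → K
  w_ne_zero : ∀ i, w i ≠ 0
  eval_l_zero : ∀ i, eval (v i) (c.l 0) = w i 0 ^ 2
  eval_l_one : ∀ i, eval (v i) (c.l 1) = w i 0 * w i 1
  eval_l_two : ∀ i, eval (v i) (c.l 2) = w i 1 ^ 2
  not_dvd : ∀ i < r, ∀ j < r, j ≠ i → ¬ rootForm (w i) ∣ rootForm (w j)

namespace ConicPoints

variable {r : ℕ} (Z : ConicPoints K r)

/-- The linear form in `s, t` vanishing at the parameter of the `i`-th point. -/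
noncomputable def u (i : ℕ) : Binary K := rootForm (Z.w i)

theorem u_prime (i : ℕ) : Prime (Z.u i) := prime_rootForm (Z.w_ne_zero i)

theorem u_isHomogeneous (i : ℕ) : (Z.u i).IsHomogeneous 1 := rootForm_isHomogeneous _

/-- The prime ideal of the `i`-th point. -/
noncomputable def ideal (i : ℕ) : Ideal (CoordRing K) := RingHom.ker (lineMap (Z.v i))

instance (i : ℕ) : (Z.ideal i).IsPrime := RingHom.ker_isPrime _

theorem mem_ideal_iff (i : ℕ) (f : CoordRing K) : f ∈ Z.ideal i ↔ Z.u i ∣ Z.c.param f := by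
  rw [ideal, RingHom.mem_ker]
  exact Z.c.lineMap_eq_zero_iff_dvd_param (Z.w_ne_zero i) (Z.eval_l_zero i) (Z.eval_l_one i)
    (Z.eval_l_two i) f

theorem exists_not_dvd_X (i : ℕ) : ∃ k : Fin 2, ¬ Z.u i ∣ X k := by
  by_contra! h
  apply Z.w_ne_zero i
  funext k
  have := (lineMap_eq_zero_iff_rootForm_dvd (Z.w_ne_zero i) (X k)).2 (h k)
  rw [lineMap_X] at this
  simpa using this

theorem hasParity_u_mul_X (i : ℕ) (k : Fin 2) : HasParity (Z.u i * X k) 0 :=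
  HasParity.mul (HasParity.of_isHomogeneous (Z.u_isHomogeneous i)) (hasParity_X k)

/-- The form u_j alone is odd and does not lift, so it is multiplied by a variable that u_i does not
divide. -/
theorem not_ideal_le {i j : ℕ} (hi : i < r) (hj : j < r) (hij : j ≠ i) :
    ¬ Z.ideal j ≤ Z.ideal i := by
  intro hle
  obtain ⟨k, hk⟩ := Z.exists_not_dvd_X i
  have h : Z.c.lift (Z.u j * X k) ∈ Z.ideal i := by
    apply hle
    rw [mem_ideal_iff, Z.c.param_lift (Z.hasParity_u_mul_X j k)]
    exact dvd_mul_right _ _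
  rw [mem_ideal_iff, Z.c.param_lift (Z.hasParity_u_mul_X j k)] at h
  rcases (Z.u_prime i).dvd_or_dvd h with h | h
  · exact Z.not_dvd i hi j hj hij h
  · exact hk h

/-- The symbolic power of the ideal of the first `r` points. -/
noncomputable def sym (m : ℕ) : Ideal (CoordRing K) :=
  symbolicPower ((Finset.range r).inf Z.ideal) m

theorem mem_sym_iff {m : ℕ} {f : CoordRing K} :
    f ∈ Z.sym m ↔ ∀ i < r, ∃ h ∉ Z.ideal i, h * f ∈ Z.ideal i ^ m := by
  rw [sym, mem_symbolicPower_iff (fun _ _ => inferInstance)]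
  · simp
  · intro i hi j hj hij
    rw [Finset.mem_range] at hi hj
    exact Z.not_ideal_le hi hj hij

theorem mem_sym_of_forall_mem {m : ℕ} {f : CoordRing K} (h : ∀ i < r, f ∈ Z.ideal i ^ m) :
    f ∈ Z.sym m :=
  Z.mem_sym_iff.2 fun i hi => ⟨1, (Ideal.ne_top_iff_one _).1 (inferInstance :
    (Z.ideal i).IsPrime).ne_top, by rw [one_mul]; exact h i hi⟩

theorem sym_zero : Z.sym 0 = ⊤ :=
  (Ideal.eq_top_iff_one _).2 (Z.mem_sym_of_forall_mem fun i _ => by simp)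

theorem conic_mem_ideal (i : ℕ) : Z.c.conic ∈ Z.ideal i := by
  rw [mem_ideal_iff, Z.c.param_conic]
  exact dvd_zero _

theorem conic_mul_mem_sym {m : ℕ} {f : CoordRing K} (hf : f ∈ Z.sym m) :
    Z.c.conic * f ∈ Z.sym (m + 1) := by
  rw [mem_sym_iff] at *
  intro i hi
  obtain ⟨h, hh, hhf⟩ := hf i hi
  refine ⟨h, hh, ?_⟩
  rw [mul_left_comm, pow_succ']
  exact Ideal.mul_mem_mul (Z.conic_mem_ideal i) hhf

/-- Locally at the i-th point the ideal is generated by the conic and a lift a of uᵢX_k, where X_k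
is not divisible by uᵢ: a lift z of X_k² is then a unit there, and z times the ideal lies in (conic,
a). Division by the conic in powers of that pair finishes the argument. -/
theorem mem_sym_of_conic_mul_mem {m : ℕ} {f : CoordRing K} (hf : Z.c.conic * f ∈ Z.sym (m + 1)) :
    f ∈ Z.sym m := by
  rw [mem_sym_iff] at *
  intro i hi
  obtain ⟨h, hh, hhf⟩ := hf i hi
  obtain ⟨k, hk⟩ := Z.exists_not_dvd_X i
  have hX2 : HasParity (X k ^ 2 : Binary K) 0 := by
    rw [sq]
    exact (hasParity_X k).mul (hasParity_X k)
  have hprime : (Z.ideal i).IsPrime := inferInstance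
  set a := Z.c.lift (Z.u i * X k) with ha
  set z := Z.c.lift (X k ^ 2) with hz
  have hpa : Z.c.param a = Z.u i * X k := Z.c.param_lift (Z.hasParity_u_mul_X i k)
  have hpz : Z.c.param z = X k ^ 2 := Z.c.param_lift hX2
  have hz' : z ∉ Z.ideal i := by
    rw [mem_ideal_iff, hpz]
    exact fun h => hk ((Z.u_prime i).dvd_of_dvd_pow h)
  have hqa : ¬ Z.c.conic ∣ a := by
    rw [← Z.c.param_eq_zero_iff, hpa]
    exact mul_ne_zero (Z.u_prime i).ne_zero (X_ne_zero _)
  have hle : Ideal.span {z} * Z.ideal i ≤ Ideal.span {Z.c.conic, a} := by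
    rw [Ideal.span_singleton_mul_le_iff]
    intro x hx
    obtain ⟨y, hy⟩ := (Z.mem_ideal_iff i x).1 hx
    have hpy : HasParity y 1 := by
      have h1 := Z.c.param_hasParity x
      rw [hy] at h1
      exact (HasParity.of_isHomogeneous (Z.u_isHomogeneous i)).of_mul_left
        (Z.u_prime i).ne_zero h1
    have hlift : Z.c.param (Z.c.lift (X k * y)) = X k * y :=
      Z.c.param_lift ((hasParity_X k).mul hpy)
    -- Both sides have image X_k² uᵢ y; here y is odd, so X_k y is even and lifts.
    obtain ⟨t, ht⟩ := (Z.c.conic_dvd_sub_iff (z * x) (a * Z.c.lift (X k * y))).2 (by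
      rw [map_mul, map_mul, hpz, hpa, hy, hlift]
      ring)
    exact Ideal.mem_span_pair.2 ⟨t, Z.c.lift (X k * y), by linear_combination -ht⟩
  have hle' : Ideal.span {Z.c.conic, a} ≤ Z.ideal i := by
    rw [Ideal.span_le]
    rintro x (rfl | rfl)
    · exact Z.conic_mem_ideal i
    · change a ∈ Z.ideal i
      rw [mem_ideal_iff, hpa]
      exact dvd_mul_right _ _
  have hmem : Z.c.conic * (z ^ (m + 1) * (h * f)) ∈ Ideal.span {Z.c.conic, a} ^ (m + 1) := by
    refine Ideal.pow_right_mono hle _ ?_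
    rw [mul_pow, Ideal.span_singleton_pow]
    have := Ideal.mul_mem_mul (Ideal.mem_span_singleton_self (z ^ (m + 1))) hhf
    convert this using 1
    ring
  refine ⟨z ^ (m + 1) * h, fun hzh => ?_, ?_⟩
  · rcases hprime.mem_or_mem hzh with h1 | h1
    · exact hz' (hprime.mem_of_pow_mem _ h1)
    · exact hh h1
  · rw [mul_assoc]
    exact Ideal.pow_right_mono hle' m (mem_span_pair_pow_of_mul_mem Z.c.prime_conic hqa hmem)

/-- The form in `s, t` vanishing at the parameters of the first `r` points. -/
noncomputable def g : Binary K := ∏ i ∈ Finset.range r, Z.u i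

theorem g_ne_zero : Z.g ≠ 0 :=
  Finset.prod_ne_zero_iff.2 fun i _ => (Z.u_prime i).ne_zero

theorem prod_u_isHomogeneous (n : ℕ) (e : ℕ → ℕ) :
    (∏ i ∈ Finset.range n, Z.u (e i)).IsHomogeneous n := by
  have := IsHomogeneous.prod (Finset.range n) (fun i => Z.u (e i)) (fun _ => 1)
    fun i _ => Z.u_isHomogeneous _
  simpa using this

theorem g_isHomogeneous : Z.g.IsHomogeneous r := Z.prod_u_isHomogeneous r id

/-- At each point, f times some h outside the prime lies in its m-th power, so uᵢ^m divides the
product of the images while uᵢ does not divide that of h. The uᵢ are pairwise coprime. -/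
theorem g_pow_dvd_param {m : ℕ} {f : CoordRing K} (hf : f ∈ Z.sym m) :
    Z.g ^ m ∣ Z.c.param f := by
  rw [g, ← Finset.prod_pow]
  refine Finset.prod_dvd_of_isRelPrime ?_ ?_
  · intro i hi j hj hij
    rw [Finset.coe_range, Set.mem_Iio] at hi hj
    refine IsRelPrime.pow ?_
    rw [(Z.u_prime i).irreducible.isRelPrime_iff_not_dvd]
    exact Z.not_dvd i hi j hj hij.symm
  · intro i hi
    obtain ⟨h, hh, hhf⟩ := Z.mem_sym_iff.1 hf i (Finset.mem_range.1 hi)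
    have hle : Z.ideal i ≤ (Ideal.span {Z.u i}).comap Z.c.param := by
      intro x hx
      rw [Ideal.mem_comap, Ideal.mem_span_singleton]
      exact (Z.mem_ideal_iff i x).1 hx
    have h1 := Ideal.le_comap_pow Z.c.param m (Ideal.pow_right_mono hle m hhf)
    rw [Ideal.mem_comap, Ideal.span_singleton_pow, Ideal.mem_span_singleton, map_mul] at h1
    rw [mem_ideal_iff] at hh
    exact (Z.u_prime i).pow_dvd_of_dvd_mul_left m hh h1

theorem exists_param_eq {m : ℕ} {f : CoordRing K} (hf : f ∈ Z.sym m) :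
    ∃ y, HasParity y ((r * m : ℕ) : ZMod 2) ∧ Z.c.param f = Z.g ^ m * y := by
  obtain ⟨y, hy⟩ := Z.g_pow_dvd_param hf
  refine ⟨y, ?_, hy⟩
  have h1 := Z.c.param_hasParity f
  rw [hy] at h1
  have h2 := (HasParity.of_isHomogeneous (Z.g_isHomogeneous.pow m)).of_mul_left
    (pow_ne_zero _ Z.g_ne_zero) h1
  rwa [zero_sub, CharTwo.neg_eq] at h2

end ConicPoints

/-! ### Bookkeeping for multisets of twists -/

theorem twists_eq_map (S : Finset ℕ) (c : ℤ → ℤ) : twists S c = S.val.map fun j : ℕ => c j := by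
  simp [twists, Multiset.bind_def, Multiset.pure_def, Multiset.bind_singleton, Multiset.map_map]

theorem twists_eq_sum (S : Finset ℕ) (c : ℤ → ℤ) : twists S c = ∑ j ∈ S, {c j} := by
  rw [twists_eq_map]
  exact (Multiset.bind_singleton _ _).symm

theorem twists_map (S : Finset ℕ) (c : ℤ → ℤ) (f : ℤ → ℤ) :
    (twists S c).map f = twists S (f ∘ c) := by
  rw [twists_eq_map, twists_eq_map, Multiset.map_map]
  rfl

theorem twists_congr {S : Finset ℕ} {c c' : ℤ → ℤ} (h : ∀ j ∈ S, c (j : ℤ) = c' j) :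
    twists S c = twists S c' := by
  rw [twists_eq_map, twists_eq_map]
  exact Multiset.map_congr rfl h

theorem twists_range_succ (n : ℕ) (c : ℤ → ℤ) :
    twists (Finset.range (n + 1)) c = twists (Finset.range n) c + {c n} := by
  rw [twists_eq_sum, twists_eq_sum, Finset.sum_range_succ]

theorem twists_Icc_succ {k n : ℕ} (h : k ≤ n + 1) (c : ℤ → ℤ) :
    twists (Finset.Icc k (n + 1)) c = twists (Finset.Icc k n) c + {c ((n + 1 : ℕ) : ℤ)} := by
  rw [twists_eq_sum, twists_eq_sum, Finset.sum_Icc_succ_top h]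

theorem twists_range_reflect (n : ℕ) (c : ℤ → ℤ) :
    twists (Finset.range n) (fun j => c (n - 1 - j)) = twists (Finset.range n) c := by
  rw [twists_eq_sum, twists_eq_sum, ← Finset.sum_range_reflect (fun j => ({c j} : Multiset ℤ))]
  refine Finset.sum_congr rfl fun j hj => ?_
  rw [Finset.mem_range] at hj
  congr 2
  omega

theorem twists_Icc_one (n : ℕ) (c : ℤ → ℤ) :
    twists (Finset.Icc 1 n) c = twists (Finset.range n) fun j => c (j + 1) := by
  induction n with
  | zero => rfl
  | succ n ih =>
    rw [twists_Icc_succ (by omega), twists_range_succ, ih]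
    push_cast
    rfl

theorem twists_Icc_zero (n : ℕ) (c : ℤ → ℤ) :
    twists (Finset.Icc 0 n) c = twists (Finset.range n) c + {c n} := by
  rw [← twists_range_succ]
  congr 1
  ext
  simp

/-! ### Even number of points -/

namespace ConicPoints

variable {r : ℕ} (Z : ConicPoints K r)

theorem mem_ideal_of_param_eq_g {F : CoordRing K} (hF : Z.c.param F = Z.g) {i : ℕ} (hi : i < r) :
    F ∈ Z.ideal i := by
  rw [mem_ideal_iff, hF]
  exact Finset.dvd_prod_of_mem _ (Finset.mem_range.2 hi)

/-- Here g is even and lifts to F. The single new generator F^(m+1) has only multiples of the conic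
as relations modulo the conic, and the conic times it is the conic times F · F^m, where F^m is the
distinguished generator one step below. -/
theorem hasPointedResolution_even_card {k : ℕ} (hk : k ≠ 0) (hr : r = 2 * k) :
    ∃ F, ∀ m : ℕ, HasPointedResolution (Z.sym m)
      (twists (Finset.Icc 0 m) fun j => -2 * (m - j) - k * j)
      (twists (Finset.Icc 1 m) fun j => -2 * (m - j) - k * j - 2) (F ^ m) (-(k * m)) := by
  have hgpar : HasParity Z.g 0 := by
    have := HasParity.of_isHomogeneous Z.g_isHomogeneous
    rwa [show ((r : ℕ) : ZMod 2) = 0 by rw [ZMod.natCast_eq_zero_iff]; exact ⟨k, hr⟩] at this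
  set F := Z.c.lift Z.g with hF
  have hFh : F.IsHomogeneous k := Z.c.lift_isHomogeneous (hr ▸ Z.g_isHomogeneous)
  have hpF : Z.c.param F = Z.g := Z.c.param_lift hgpar
  have hFdvd : ¬ Z.c.conic ∣ F := by
    rw [← Z.c.param_eq_zero_iff, hpF]
    exact Z.g_ne_zero
  have hFsym : ∀ m, F ^ m ∈ Z.sym m := fun m => Z.mem_sym_of_forall_mem fun i hi =>
    Ideal.pow_mem_pow (Z.mem_ideal_of_param_eq_g hpF hi) m
  refine ⟨F, fun m => ?_⟩
  induction m with
  | zero =>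
    have := hasPointedResolution_top Z.sym_zero
    simpa [twists_eq_map] using this
  | succ m ih =>
    have key := ih.extend (J := Z.sym (m + 1)) (ι' := Unit) (κ' := Unit) ()
      Z.c.conic_isHomogeneous Z.c.conic_ne_zero (fun x hx => Z.conic_mul_mem_sym hx)
      (f := fun _ => F ^ (m + 1)) (a' := fun _ => -(k * (m + 1 : ℕ)))
      (N := fun _ _ => Z.c.conic) (c := fun _ => F) (b' := fun _ => -(k * (m + 1 : ℕ)) - 2)
      (fun _ => hFsym _) (fun _ => ?_) ?_ (fun _ _ => ?_) (fun _ => ?_) (fun _ _ => ?_)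
      (fun _ => ?_) (fun _ => ?_) ?_ ?_
    · convert key using 1
      · rw [twists_Icc_succ (by omega), twists_map]
        congr 1
        · refine twists_congr fun j _ => ?_
          simp only [Function.comp_apply]
          push_cast
          ring
        · simp
      · rw [twists_Icc_succ (by omega), twists_map]
        congr 1
        · refine twists_congr fun j _ => ?_
          simp only [Function.comp_apply]
          push_cast
          ring
        · simp
    · have := mem_piece_natCast.2 (hFh.pow (m + 1))
      simpa using this
    · intro x hx
      obtain ⟨y, hy, hxy⟩ := Z.exists_param_eq hx
      rw [show ((r * (m + 1) : ℕ) : ZMod 2) = 0 by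
        rw [ZMod.natCast_eq_zero_iff]; exact ⟨k * (m + 1), by rw [hr]; ring⟩] at hy
      obtain ⟨x', hx'⟩ := (Z.c.conic_dvd_sub_iff x (F ^ (m + 1) * Z.c.lift y)).2 (by
        rw [hxy, map_mul, map_pow, hpF, Z.c.param_lift hy])
      refine ⟨x', ?_, fun _ => Z.c.lift y, ?_⟩
      · apply Z.mem_sym_of_conic_mul_mem
        rw [← hx']
        exact Ideal.sub_mem _ hx (Ideal.mul_mem_right _ _ (hFsym _))
      · rw [Fintype.sum_unique]
        linear_combination hx'
    · have := mem_piece_natCast.2 Z.c.conic_isHomogeneous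
      simpa using this
    · have := mem_piece_natCast.2 hFh
      convert this using 2
      push_cast
      ring
    · exact mem_irrelevant_of_isHomogeneous two_ne_zero Z.c.conic_isHomogeneous
    · exact mem_irrelevant_of_isHomogeneous hk hFh
    · rw [Fintype.sum_unique]
      ring
    · intro v hv
      rw [Fintype.sum_unique] at hv
      obtain ⟨t, ht⟩ := (Z.c.prime_conic.dvd_or_dvd hv).resolve_right fun h =>
        hFdvd (Z.c.prime_conic.dvd_of_dvd_pow h)
      exact ⟨fun _ => t, fun _ => by rw [Fintype.sum_unique, mul_comm t]; exact ht⟩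
    · intro w hw
      funext i
      have := hw ()
      rw [Fintype.sum_unique] at this
      exact (mul_eq_zero.1 this).resolve_right Z.c.conic_ne_zero

end ConicPoints

/-! ### Odd number of points: the forms F, A, B -/

namespace ConicPoints

variable {r : ℕ} (Z : ConicPoints K r)

theorem param_C (c : Coordinates K) (k : K) : c.param (C k) = C k := by
  rw [← MvPolynomial.algebraMap_eq, AlgHom.commutes, MvPolynomial.algebraMap_eq]

/-- Forms generating the symbolic powers of the ideal of an odd number `2 k + 1` of points on the
conic, and relations among them. -/
structure OddGenerators (k : ℕ) where
  /-- the form of degree `r` that is singular at all points -/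
  F : CoordRing K
  /-- a form of degree `k + 1` through all points -/
  A : CoordRing K
  /-- another form of degree `k + 1` through all points -/
  B : CoordRing K
  /-- coefficient of the conic in a relation -/
  C₁ : CoordRing K
  /-- coefficient of the conic in a relation -/
  C₂ : CoordRing K
  /-- coefficient of the conic in a relation -/
  D : CoordRing K
  hF : F.IsHomogeneous r
  hA : A.IsHomogeneous (k + 1)
  hB : B.IsHomogeneous (k + 1)
  hC₁ : C₁.IsHomogeneous k
  hC₂ : C₂.IsHomogeneous k
  hD : D.IsHomogeneous (r - 2)
  param_F : Z.c.param F = Z.g ^ 2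
  param_A : Z.c.param A = X 0 * Z.g
  param_B : Z.c.param B = X 1 * Z.g
  F_mem : ∀ i < r, F ∈ Z.ideal i ^ 2
  F_eq : F = C₂ * A - C₁ * B + D * Z.c.conic
  rel₁ : Z.c.l 1 * A - Z.c.l 0 * B = C₁ * Z.c.conic
  rel₂ : Z.c.l 2 * A - Z.c.l 1 * B = C₂ * Z.c.conic

/-- Write g² as p · p' · (u_{2k}u₀), where p omits the last factor of g and p' the first. All three
are even and lift to M, M', L. Every point lies on at least two of these curves, so F = MM'L lies in
the square of each point ideal. With S and T lifting s u_{2k} and t u_{2k}, set A = MS and B = MT.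
-/
theorem nonempty_oddGenerators {k : ℕ} (hk : k ≠ 0) (hr : r = 2 * k + 1) :
    Nonempty (Z.OddGenerators k) := by
  set p := ∏ i ∈ Finset.range (2 * k), Z.u i with hp
  set p' := ∏ i ∈ Finset.range (2 * k), Z.u (i + 1) with hp'
  have hph : p.IsHomogeneous (2 * k) := Z.prod_u_isHomogeneous _ id
  have hph' : p'.IsHomogeneous (2 * k) := Z.prod_u_isHomogeneous _ (· + 1)
  have hgp : Z.g = p * Z.u (2 * k) := 
    (congrArg (fun n => ∏ i ∈ Finset.range n, Z.u i) hr).trans (Finset.prod_range_succ _ _)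
  have hgp' : Z.g = p' * Z.u 0 := 
    (congrArg (fun n => ∏ i ∈ Finset.range n, Z.u i) hr).trans (Finset.prod_range_succ' _ _)
  have hpar : ∀ {q : Binary K} {n : ℕ}, q.IsHomogeneous (2 * n) → HasParity q 0 := by
    intro q n hq
    have := HasParity.of_isHomogeneous hq
    rwa [show ((2 * n : ℕ) : ZMod 2) = 0 by rw [ZMod.natCast_eq_zero_iff]; exact ⟨n, rfl⟩] at this
  have huh : (Z.u (2 * k) * Z.u 0).IsHomogeneous (2 * 1) :=
    (Z.u_isHomogeneous _).mul (Z.u_isHomogeneous _)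
  set M := Z.c.lift p
  set M' := Z.c.lift p'
  set L := Z.c.lift (Z.u (2 * k) * Z.u 0)
  have hM : Z.c.param M = p := Z.c.param_lift (hpar hph)
  have hM' : Z.c.param M' = p' := Z.c.param_lift (hpar hph')
  have hL : Z.c.param L = Z.u (2 * k) * Z.u 0 := Z.c.param_lift (hpar huh)
  have hMh : M.IsHomogeneous k := Z.c.lift_isHomogeneous hph
  have hM'h : M'.IsHomogeneous k := Z.c.lift_isHomogeneous hph'
  have hLh : L.IsHomogeneous 1 := Z.c.lift_isHomogeneous huh
  set w := Z.w (2 * k)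
  have hu : Z.u (2 * k) = C (w 1) * X 0 - C (w 0) * X 1 := rfl
  set S := C (w 1) * Z.c.l 0 - C (w 0) * Z.c.l 1 with hS
  set T := C (w 1) * Z.c.l 1 - C (w 0) * Z.c.l 2 with hT
  have hSh : S.IsHomogeneous 1 := ((Z.c.l_isHomogeneous 0).C_mul _).sub
    ((Z.c.l_isHomogeneous 1).C_mul _)
  have hTh : T.IsHomogeneous 1 := ((Z.c.l_isHomogeneous 1).C_mul _).sub
    ((Z.c.l_isHomogeneous 2).C_mul _)
  have hpS : Z.c.param S = X 0 * Z.u (2 * k) := by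
    rw [hS, hu, map_sub, map_mul, map_mul, param_C, param_C, Z.c.param_l_zero, Z.c.param_l_one]
    ring
  have hpT : Z.c.param T = X 1 * Z.u (2 * k) := by
    rw [hT, hu, map_sub, map_mul, map_mul, param_C, param_C, Z.c.param_l_two, Z.c.param_l_one]
    ring
  have hpF : Z.c.param (M * M' * L) = Z.g ^ 2 := by
    rw [map_mul, map_mul, hM, hM', hL, sq]
    nth_rewrite 1 [hgp]
    rw [hgp']
    ring
  have hFh : (M * M' * L).IsHomogeneous r := by
    convert (hMh.mul hM'h).mul hLh using 1
    omega
  have hCh : ∀ a : K, (C a * M).IsHomogeneous k := fun a => hMh.C_mul a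
  -- The combination w₁A - w₀B has image (w₁s - w₀t)g = u_{2k}g, and multiplying by p gives g².
  obtain ⟨D, hD⟩ := (Z.c.conic_dvd_sub_iff (M * M' * L)
    (C (w 1) * M * (M * S) - C (w 0) * M * (M * T))).2 (by
      rw [hpF]
      simp only [map_sub, map_mul, param_C, hM, hpS, hpT]
      rw [hgp, hu]
      ring)
  have hDh : D.IsHomogeneous (r - 2) := by
    have h1 : (Z.c.conic * D).IsHomogeneous r := by
      rw [← hD]
      refine hFh.sub (IsHomogeneous.sub ?_ ?_)
      · have := (hCh (w 1)).mul (hMh.mul hSh)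
        rwa [show k + (k + 1) = r by omega] at this
      · have := (hCh (w 0)).mul (hMh.mul hTh)
        rwa [show k + (k + 1) = r by omega] at this
    rw [← isWeightedHomogeneous_one_int] at h1 ⊢
    have h2 := isWeightedHomogeneous_of_mul_left
      (isWeightedHomogeneous_one_int.2 Z.c.conic_isHomogeneous) Z.c.conic_ne_zero h1
    rwa [show (r : ℤ) - (2 : ℕ) = (r - 2 : ℕ) by omega] at h2
  refine ⟨⟨M * M' * L, M * S, M * T, C (w 0) * M, C (w 1) * M, D, hFh, hMh.mul hSh, hMh.mul hTh,
    hCh _, hCh _, hDh, hpF, ?_, ?_, ?_, ?_, ?_, ?_⟩⟩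
  · rw [map_mul, hM, hpS, hgp]
    ring
  · rw [map_mul, hM, hpT, hgp]
    ring
  · intro i hi
    have h1 : i < 2 * k → M ∈ Z.ideal i := fun h => by
      rw [mem_ideal_iff, hM]
      exact Finset.dvd_prod_of_mem _ (Finset.mem_range.2 h)
    have h2 : i ≠ 0 → M' ∈ Z.ideal i := fun h => by
      rw [mem_ideal_iff, hM']
      have : Z.u i = Z.u ((i - 1) + 1) := by congr 1; omega
      rw [this]
      exact Finset.dvd_prod_of_mem (fun i => Z.u (i + 1)) (Finset.mem_range.2 (by omega))
    rw [sq]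
    by_cases hi0 : i = 0
    · rw [mul_right_comm]
      refine Ideal.mul_mem_right _ _ (Ideal.mul_mem_mul (h1 (by omega)) ?_)
      rw [mem_ideal_iff, hL, hi0]
      exact dvd_mul_left _ _
    · by_cases hik : i = 2 * k
      · rw [mul_assoc]
        refine Ideal.mul_mem_left _ _ (Ideal.mul_mem_mul (h2 hi0) ?_)
        rw [mem_ideal_iff, hL, hik]
        exact dvd_mul_right _ _
      · exact Ideal.mul_mem_right _ _ (Ideal.mul_mem_mul (h1 (by omega)) (h2 hi0))
  · linear_combination hD
  · rw [hS, hT, Coordinates.conic]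
    ring
  · rw [hS, hT, Coordinates.conic]
    ring

end ConicPoints

/-! ### Odd number of points: the induction in steps of two -/

namespace ConicPoints

variable {r : ℕ} {Z : ConicPoints K r}

namespace OddGenerators

variable {k : ℕ} (G : Z.OddGenerators k)

theorem not_conic_dvd_F : ¬ Z.c.conic ∣ G.F := by
  rw [← Z.c.param_eq_zero_iff, G.param_F]
  exact pow_ne_zero _ Z.g_ne_zero

theorem conic_dvd_of_dvd_F_pow_mul {μ : ℕ} {x : CoordRing K} (h : Z.c.conic ∣ G.F ^ μ * x) :
    Z.c.conic ∣ x :=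
  (Z.c.prime_conic.dvd_or_dvd h).resolve_left fun h =>
    G.not_conic_dvd_F (Z.c.prime_conic.dvd_of_dvd_pow h)

theorem F_pow_mem_sym (μ : ℕ) : G.F ^ μ ∈ Z.sym (2 * μ) :=
  Z.mem_sym_of_forall_mem fun i hi => by
    rw [pow_mul]
    exact Ideal.pow_mem_pow (G.F_mem i hi) μ

theorem F_pow_mul_mem_sym {H : CoordRing K} {x : Binary K} (μ : ℕ)
    (hH : Z.c.param H = x * Z.g) : G.F ^ μ * H ∈ Z.sym (2 * μ + 1) :=
  Z.mem_sym_of_forall_mem fun i hi => by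
    rw [pow_succ, pow_mul]
    refine Ideal.mul_mem_mul (Ideal.pow_mem_pow (G.F_mem i hi) μ) ?_
    rw [mem_ideal_iff, hH]
    exact (Finset.dvd_prod_of_mem _ (Finset.mem_range.2 hi)).mul_left _

/-- The generators of `I^(2 μ + 2)` that are not multiples of the square of the conic. -/
noncomputable def gens (μ : ℕ) : Fin 3 → CoordRing K :=
  ![G.F ^ (μ + 1), Z.c.conic * (G.F ^ μ * G.A), Z.c.conic * (G.F ^ μ * G.B)]

/-- The matrix of relations among `gens` modulo the square of the conic. -/
noncomputable def rels : Fin 3 → Fin 3 → CoordRing K :=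
  ![![Z.c.conic, -G.C₂, G.C₁], ![0, Z.c.l 1, -Z.c.l 0], ![0, Z.c.l 2, -Z.c.l 1]]

/-- The coefficients of the square of the conic in the relations among `gens`. -/
noncomputable def coeffs : Fin 3 → CoordRing K := ![G.D, G.C₁, G.C₂]

theorem sum_gens (μ : ℕ) (v : Fin 3 → CoordRing K) : ∑ i, v i * G.gens μ i =
    v 0 * G.F ^ (μ + 1) + v 1 * (Z.c.conic * (G.F ^ μ * G.A)) +
      v 2 * (Z.c.conic * (G.F ^ μ * G.B)) := by
  rw [Fin.sum_univ_three]
  rfl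

theorem sum_rels_zero (w : Fin 3 → CoordRing K) : ∑ j, w j * G.rels j 0 = w 0 * Z.c.conic := by
  rw [Fin.sum_univ_three]
  simp [rels]

theorem sum_rels_one (w : Fin 3 → CoordRing K) :
    ∑ j, w j * G.rels j 1 = w 0 * -G.C₂ + w 1 * Z.c.l 1 + w 2 * Z.c.l 2 := by
  rw [Fin.sum_univ_three]
  rfl

theorem sum_rels_two (w : Fin 3 → CoordRing K) :
    ∑ j, w j * G.rels j 2 = w 0 * G.C₁ + w 1 * -Z.c.l 0 + w 2 * -Z.c.l 1 := by
  rw [Fin.sum_univ_three]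
  rfl

theorem gens_mem_sym (μ : ℕ) (i : Fin 3) : G.gens μ i ∈ Z.sym (2 * (μ + 1)) := by
  fin_cases i
  · exact G.F_pow_mem_sym _
  · exact Z.conic_mul_mem_sym (G.F_pow_mul_mem_sym μ G.param_A)
  · exact Z.conic_mul_mem_sym (G.F_pow_mul_mem_sym μ G.param_B)

theorem gens_mem_piece (μ : ℕ) (i : Fin 3) : G.gens μ i ∈
    piece K (-(![-(r * (μ + 1)), -(r * μ + k + 3), -(r * μ + k + 3)] : Fin 3 → ℤ) i) := by
  have h : ∀ {H : CoordRing K}, H.IsHomogeneous (k + 1) →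
      Z.c.conic * (G.F ^ μ * H) ∈ piece K (r * μ + k + 3) := by
    intro H hH
    have := mem_piece_natCast.2 (Z.c.conic_isHomogeneous.mul ((G.hF.pow μ).mul hH))
    rwa [show ((2 + (r * μ + (k + 1)) : ℕ) : ℤ) = r * μ + k + 3 by push_cast; ring] at this
  fin_cases i
  · have := mem_piece_natCast.2 (G.hF.pow (μ + 1))
    simpa [gens] using this
  · simpa [gens] using h G.hA
  · simpa [gens] using h G.hB

theorem rels_mem_piece (hr : r = 2 * k + 1) (μ : ℕ) (j i : Fin 3) : G.rels j i ∈
    piece K ((![-(r * (μ + 1)), -(r * μ + k + 3), -(r * μ + k + 3)] : Fin 3 → ℤ) i -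
      (![-(r * (μ + 1)) - 2, -(r * μ + k + 4), -(r * μ + k + 4)] : Fin 3 → ℤ) j) := by
  have hr' : (r : ℤ) = 2 * k + 1 := by exact_mod_cast hr
  have h : ∀ {H : CoordRing K} {n : ℕ} {e : ℤ}, H.IsHomogeneous n → e = n → H ∈ piece K e := by
    rintro H n _ hH rfl
    exact mem_piece_natCast.2 hH
  fin_cases j <;> fin_cases i <;> simp only [rels, Matrix.cons_val, Fin.zero_eta, Fin.mk_one,
    Fin.reduceFinMk]
  · exact h Z.c.conic_isHomogeneous (by push_cast; ring)
  · exact h G.hC₂.neg (by rw [hr']; ring)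
  · exact h G.hC₁ (by rw [hr']; ring)
  · exact zero_mem _
  · exact h (Z.c.l_isHomogeneous 1) (by push_cast; ring)
  · exact h (Z.c.l_isHomogeneous 0).neg (by push_cast; ring)
  · exact zero_mem _
  · exact h (Z.c.l_isHomogeneous 2) (by push_cast; ring)
  · exact h (Z.c.l_isHomogeneous 1).neg (by push_cast; ring)

theorem coeffs_mem_piece (hk : k ≠ 0) (hr : r = 2 * k + 1) (μ : ℕ) (j : Fin 3) : G.coeffs j ∈
    piece K (-(r * μ) - (2 * 2 : ℕ) -
      (![-(r * (μ + 1)) - 2, -(r * μ + k + 4), -(r * μ + k + 4)] : Fin 3 → ℤ) j) := by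
  have h : ∀ {H : CoordRing K} {n : ℕ} {e : ℤ}, H.IsHomogeneous n → e = n → H ∈ piece K e := by
    rintro H n _ hH rfl
    exact mem_piece_natCast.2 hH
  have hr2 : ((r - 2 : ℕ) : ℤ) = r - 2 := by omega
  fin_cases j <;> simp only [coeffs, Matrix.cons_val, Fin.zero_eta, Fin.mk_one, Fin.reduceFinMk]
  · exact h G.hD (by rw [hr2]; push_cast; ring)
  · exact h G.hC₁ (by push_cast; ring)
  · exact h G.hC₂ (by push_cast; ring)

theorem rels_mem_irrelevant (hk : k ≠ 0) (j i : Fin 3) :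
    G.rels j i ∈ Ideal.span (Set.range (X : Fin 3 → CoordRing K)) := by
  have hl := fun i => mem_irrelevant_of_isHomogeneous one_ne_zero (Z.c.l_isHomogeneous i)
  fin_cases j <;> fin_cases i <;> simp only [rels, Matrix.cons_val, Fin.zero_eta, Fin.mk_one,
    Fin.reduceFinMk]
  · exact mem_irrelevant_of_isHomogeneous two_ne_zero Z.c.conic_isHomogeneous
  · exact mem_irrelevant_of_isHomogeneous hk G.hC₂.neg
  · exact mem_irrelevant_of_isHomogeneous hk G.hC₁
  · exact zero_mem _
  · exact hl 1
  · exact neg_mem (hl 0)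
  · exact zero_mem _
  · exact hl 2
  · exact neg_mem (hl 1)

theorem coeffs_mem_irrelevant (hk : k ≠ 0) (hr : r = 2 * k + 1) (j : Fin 3) :
    G.coeffs j ∈ Ideal.span (Set.range (X : Fin 3 → CoordRing K)) := by
  fin_cases j
  · exact mem_irrelevant_of_isHomogeneous (by omega) G.hD
  · exact mem_irrelevant_of_isHomogeneous hk G.hC₁
  · exact mem_irrelevant_of_isHomogeneous hk G.hC₂

theorem sum_rels_mul_gens (μ : ℕ) (j : Fin 3) : ∑ i, G.rels j i * G.gens μ i =
    Z.c.conic ^ 2 * (G.coeffs j * G.F ^ μ) := by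
  rw [sum_gens]
  fin_cases j <;> simp only [rels, coeffs, Matrix.cons_val, Fin.zero_eta, Fin.mk_one,
    Fin.reduceFinMk]
  · linear_combination Z.c.conic * G.F ^ μ * G.F_eq
  · linear_combination Z.c.conic * G.F ^ μ * G.rel₁
  · linear_combination Z.c.conic * G.F ^ μ * G.rel₂

/-- Two successive divisions by the conic. First the cofactor of g^(2μ+2) is even and lifts as a
multiple of F^(μ+1). Then the cofactor of g^(2μ+1) is odd, hence of the form s y₀ + t y₁, which A
and B realize. -/
theorem exists_eq_add (hr : r = 2 * k + 1) (μ : ℕ) {x : CoordRing K}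
    (hx : x ∈ Z.sym (2 * (μ + 1))) : ∃ y ∈ Z.sym (2 * μ), ∃ v : Fin 3 → CoordRing K,
      x = Z.c.conic ^ 2 * y + ∑ i, v i * G.gens μ i := by
  have hrpar : ∀ n : ℕ, ((r * n : ℕ) : ZMod 2) = (n : ZMod 2) := by
    intro n
    rw [hr]
    push_cast
    rw [show (2 : ZMod 2) = 0 from rfl]
    ring
  obtain ⟨y, hy, hxy⟩ := Z.exists_param_eq hx
  rw [hrpar, show ((2 * (μ + 1) : ℕ) : ZMod 2) = 0 by
    rw [ZMod.natCast_eq_zero_iff]; exact ⟨μ + 1, rfl⟩] at hy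
  obtain ⟨x', hx'⟩ := (Z.c.conic_dvd_sub_iff x (G.F ^ (μ + 1) * Z.c.lift y)).2 (by
    rw [hxy, map_mul, map_pow, G.param_F, Z.c.param_lift hy]
    ring)
  have hx'm : x' ∈ Z.sym (2 * μ + 1) := by
    apply Z.mem_sym_of_conic_mul_mem
    rw [← hx', show 2 * μ + 1 + 1 = 2 * (μ + 1) by ring]
    exact Ideal.sub_mem _ hx (Ideal.mul_mem_right _ _ (G.F_pow_mem_sym _))
  obtain ⟨y', hy', hxy'⟩ := Z.exists_param_eq hx'm
  rw [hrpar, show ((2 * μ + 1 : ℕ) : ZMod 2) = 1 by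
    push_cast; rw [show (2 : ZMod 2) = 0 from rfl]; ring] at hy'
  obtain ⟨y₀, y₁, hy₀, hy₁, rfl⟩ := hy'.exists_eq_add
  obtain ⟨x'', hx''⟩ := (Z.c.conic_dvd_sub_iff x'
    (G.F ^ μ * G.A * Z.c.lift y₀ + G.F ^ μ * G.B * Z.c.lift y₁)).2 (by
      rw [hxy']
      simp only [map_add, map_mul, map_pow, G.param_F, G.param_A, G.param_B, Z.c.param_lift hy₀,
        Z.c.param_lift hy₁]
      ring)
  refine ⟨x'', ?_, ![Z.c.lift y, Z.c.lift y₀, Z.c.lift y₁], ?_⟩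
  · apply Z.mem_sym_of_conic_mul_mem
    rw [← hx'']
    exact Ideal.sub_mem _ hx'm (Ideal.add_mem _
      (Ideal.mul_mem_right _ _ (G.F_pow_mul_mem_sym μ G.param_A))
      (Ideal.mul_mem_right _ _ (G.F_pow_mul_mem_sym μ G.param_B)))
  · rw [sum_gens]
    simp only [Matrix.cons_val]
    linear_combination hx' + Z.c.conic * hx''

/-- Cancelling g leaves s x̄ + t ȳ = 0, so x̄ = te and ȳ = -se. As e is odd, e = s e₁ + t e₂, and
the two summands give the two relations modulo the conic. -/
theorem exists_of_conic_dvd_mul_add_mul {x y : CoordRing K}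
    (h : Z.c.conic ∣ x * G.A + y * G.B) : ∃ a b : CoordRing K,
      x = a * Z.c.l 1 + b * Z.c.l 2 ∧ y = a * -Z.c.l 0 + b * -Z.c.l 1 := by
  rw [← Z.c.param_eq_zero_iff, map_add, map_mul, map_mul, G.param_A, G.param_B] at h
  have hsyz : X 0 * Z.c.param x + X 1 * Z.c.param y = 0 := by
    apply mul_left_cancel₀ Z.g_ne_zero
    rw [mul_zero]
    linear_combination h
  have hX : (X 1 : Binary K) ∣ Z.c.param x := by
    have h1 : (X 1 : Binary K) ∣ X 0 * Z.c.param x :=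
      ⟨-Z.c.param y, by linear_combination hsyz⟩
    refine ((X_prime (i := (1 : Fin 2))).dvd_or_dvd h1).resolve_left fun h => ?_
    rw [X_dvd_X] at h
    simp at h
  obtain ⟨e, he⟩ := hX
  have he' : Z.c.param y = -(X 0 * e) := by
    apply mul_left_cancel₀ (X_ne_zero (1 : Fin 2) : (X 1 : Binary K) ≠ 0)
    rw [he] at hsyz
    linear_combination hsyz
  have hep : HasParity e 1 := by
    have h1 := Z.c.param_hasParity x
    rw [he] at h1
    exact (hasParity_X 1).of_mul_left (X_ne_zero _) h1
  obtain ⟨e₁, e₂, he₁, he₂, rfl⟩ := hep.exists_eq_add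
  obtain ⟨h₁, hh₁⟩ := (Z.c.conic_dvd_sub_iff x
    (Z.c.l 1 * Z.c.lift e₁ + Z.c.l 2 * Z.c.lift e₂)).2 (by
      rw [he]
      simp only [map_add, map_mul, Z.c.param_l_one, Z.c.param_l_two, Z.c.param_lift he₁,
        Z.c.param_lift he₂]
      ring)
  obtain ⟨h₂, hh₂⟩ := (Z.c.conic_dvd_sub_iff y
    (-(Z.c.l 0 * Z.c.lift e₁ + Z.c.l 1 * Z.c.lift e₂))).2 (by
      rw [he']
      simp only [map_add, map_mul, map_neg, Z.c.param_l_one, Z.c.param_l_zero,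
        Z.c.param_lift he₁, Z.c.param_lift he₂]
      ring)
  rw [Coordinates.conic] at hh₁ hh₂
  -- The error terms conic · h₁ and conic · h₂ are absorbed into the same relations, whose 2 × 2
  -- determinant is the conic.
  exact ⟨Z.c.lift e₁ - Z.c.l 1 * h₁ - Z.c.l 2 * h₂, Z.c.lift e₂ + Z.c.l 0 * h₁ + Z.c.l 1 * h₂,
    by linear_combination hh₁, by linear_combination hh₂⟩

/-- Modulo the conic only F^(μ+1) survives, so the conic divides v₀. Rewriting F through A, B and
the conic and cancelling one conic reduces to a relation between A and B modulo the conic. -/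
theorem exists_eq_sum_rels (μ : ℕ) {v : Fin 3 → CoordRing K}
    (hv : Z.c.conic ^ 2 ∣ ∑ i, v i * G.gens μ i) :
    ∃ w : Fin 3 → CoordRing K, ∀ i, v i = ∑ j, w j * G.rels j i := by
  rw [sum_gens] at hv
  obtain ⟨t, ht⟩ := hv
  obtain ⟨v₀, hv₀⟩ : Z.c.conic ∣ v 0 := G.conic_dvd_of_dvd_F_pow_mul (μ := μ + 1)
    ⟨Z.c.conic * t - v 1 * (G.F ^ μ * G.A) - v 2 * (G.F ^ μ * G.B), by linear_combination ht⟩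
  have hdvd : Z.c.conic ∣ (v 1 + G.C₂ * v₀) * G.A + (v 2 - G.C₁ * v₀) * G.B := by
    refine G.conic_dvd_of_dvd_F_pow_mul (μ := μ) ⟨t - G.F ^ μ * v₀ * G.D, ?_⟩
    apply mul_left_cancel₀ Z.c.conic_ne_zero
    rw [hv₀] at ht
    linear_combination ht - Z.c.conic * v₀ * G.F ^ μ * G.F_eq
  obtain ⟨a, b, h₁, h₂⟩ := G.exists_of_conic_dvd_mul_add_mul hdvd
  refine ⟨![v₀, a, b], fun i => ?_⟩
  fin_cases i
  · refine Eq.trans ?_ (G.sum_rels_zero _).symm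
    simp only [Matrix.cons_val, Fin.zero_eta]
    linear_combination hv₀
  · refine Eq.trans ?_ (G.sum_rels_one _).symm
    simp only [Matrix.cons_val, Fin.mk_one]
    linear_combination h₁
  · refine Eq.trans ?_ (G.sum_rels_two _).symm
    simp only [Matrix.cons_val, Fin.reduceFinMk]
    linear_combination h₂

/-- The matrix is block triangular, with diagonal entry the conic and a 2 × 2 block whose
determinant is again the conic. -/
theorem eq_zero_of_sum_rels_eq_zero {w : Fin 3 → CoordRing K}
    (hw : ∀ i, ∑ j, w j * G.rels j i = 0) : w = 0 := by
  have e0 := hw 0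
  have e1 := hw 1
  have e2 := hw 2
  rw [sum_rels_zero] at e0
  rw [sum_rels_one] at e1
  rw [sum_rels_two] at e2
  have w0 : w 0 = 0 := (mul_eq_zero.1 e0).resolve_right Z.c.conic_ne_zero
  rw [w0] at e1 e2
  have w1 : w 1 = 0 := by
    apply mul_left_cancel₀ Z.c.conic_ne_zero
    rw [Coordinates.conic]
    linear_combination (-Z.c.l 1) * e1 - Z.c.l 2 * e2
  have w2 : w 2 = 0 := by
    apply mul_left_cancel₀ Z.c.conic_ne_zero
    rw [Coordinates.conic]
    linear_combination Z.c.l 0 * e1 + Z.c.l 1 * e2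
  funext j
  fin_cases j
  · exact w0
  · exact w1
  · exact w2

theorem hasPointedResolution (hk : k ≠ 0) (hr : r = 2 * k + 1) (μ : ℕ) :
    HasPointedResolution (Z.sym (2 * μ))
      (twists (Finset.Icc 0 μ) (fun j => -4 * μ - j * (r - 4)) +
        2 • twists (Finset.range μ) (fun j => -4 * μ - j * (r - 4) - k + 1))
      (twists (Finset.Icc 1 μ) (fun j => -4 * μ - j * (r - 4) - 2) +
        2 • twists (Finset.range μ) (fun j => -4 * μ - j * (r - 4) - k))
      (G.F ^ μ) (-(r * μ)) := by
  induction μ with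
  | zero =>
    have := hasPointedResolution_top Z.sym_zero
    simpa [twists_eq_map] using this
  | succ μ ih =>
    have key := ih.extend (J := Z.sym (2 * (μ + 1))) 0
      (Z.c.conic_isHomogeneous.pow 2) (pow_ne_zero 2 Z.c.conic_ne_zero)
      (fun x hx => by
        rw [sq, mul_assoc]
        exact Z.conic_mul_mem_sym (Z.conic_mul_mem_sym hx))
      (G.gens_mem_sym μ) (G.gens_mem_piece μ) (fun x hx => G.exists_eq_add hr μ hx)
      (G.rels_mem_piece hr μ) (G.coeffs_mem_piece hk hr μ) (G.rels_mem_irrelevant hk)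
      (G.coeffs_mem_irrelevant hk hr) (G.sum_rels_mul_gens μ)
      (fun v hv => G.exists_eq_sum_rels μ hv) (fun w hw => G.eq_zero_of_sum_rels_eq_zero hw)
    have huniv : ∀ a b : ℤ, (Finset.univ : Finset (Fin 3)).val.map ![a, b, b] =
        {a} + 2 • {b} := by
      intro a b
      rw [two_nsmul]
      rfl
    rw [huniv, huniv] at key
    convert key using 1
    · rw [twists_Icc_succ (by omega), twists_range_succ, Multiset.map_add, Multiset.map_nsmul,
        twists_map, twists_map, nsmul_add, add_add_add_comm]
      congr 3
      · funext j
        simp only [Function.comp_apply]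
        push_cast
        ring
      · refine twists_congr fun j _ => ?_
        simp only [Function.comp_apply]
        push_cast
        ring
      · push_cast
        ring
      · push_cast
        ring_nf
    · rw [twists_Icc_succ (by omega), twists_range_succ, Multiset.map_add, Multiset.map_nsmul,
        twists_map, twists_map, nsmul_add, add_add_add_comm]
      congr 3
      · funext j
        simp only [Function.comp_apply]
        push_cast
        ring
      · refine twists_congr fun j _ => ?_
        simp only [Function.comp_apply]
        push_cast
        ring
      · push_cast
        ring
      · push_cast
        ring_nf
    · rfl
    · simp only [Matrix.cons_val_zero]
      push_cast
      ring

end OddGenerators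

end ConicPoints

/-! ### From a finite set of points to parametrized points -/

section FromPoints

theorem eval_smul_of_isHomogeneous {σ : Type*} {f : MvPolynomial σ K} {n : ℕ}
    (hf : f.IsHomogeneous n) (t : K) (v : σ → K) : eval (t • v) f = t ^ n * eval v f := by
  have h : (Polynomial.aeval t).comp (lineMap v) = aeval (t • v) := by
    refine algHom_ext fun i => ?_
    rw [AlgHom.comp_apply, lineMap_X, map_mul, Polynomial.aeval_C, Polynomial.aeval_X, aeval_X,
      Pi.smul_apply, smul_eq_mul, Algebra.algebraMap_self_apply, mul_comm]
  have h1 := AlgHom.congr_fun h f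
  rw [AlgHom.comp_apply, lineMap_of_isHomogeneous v hf, aeval_eq_eval] at h1
  rw [← h1, map_mul, map_pow, Polynomial.aeval_C, Polynomial.aeval_X,
    Algebra.algebraMap_self_apply, mul_comm]

theorem Coordinates.eq_of_eval_eq (c : Coordinates K) {x y : Fin 3 → K}
    (h : ∀ i, eval x (c.l i) = eval y (c.l i)) : x = y := by
  have key : ∀ f : CoordRing K, eval x f = eval y f := by
    intro f
    induction f using c.induction_coordinates with
    | hC k => simp
    | hadd f g hf hg => rw [map_add, map_add, hf, hg]
    | hmul f i hf => rw [map_mul, map_mul, hf, h]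
  funext i
  simpa using key (X i)

theorem Coordinates.eval_smul_l (c : Coordinates K) (t : K) (v : Fin 3 → K) (i : Fin 3) :
    eval (t • v) (c.l i) = t * eval v (c.l i) := by
  rw [eval_smul_of_isHomogeneous (c.l_isHomogeneous i), pow_one]

/-- No square root is needed: scaling a representative by its own coordinate l₀ gives (l₀², l₀l₁,
l₁²), using l₀l₂ = l₁². If l₀ = 0 then l₁ = 0, and scaling by l₂ works. -/
theorem Coordinates.exists_param_of_vanishesAt (c : Coordinates K) {p : Plane K}
    (hp : VanishesAt c.conic p) : ∃ (v : Fin 3 → K) (w : Fin 2 → K) (hv : v ≠ 0),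
      Projectivization.mk K v hv = p ∧ w ≠ 0 ∧ eval v (c.l 0) = w 0 ^ 2 ∧
        eval v (c.l 1) = w 0 * w 1 ∧ eval v (c.l 2) = w 1 ^ 2 := by
  have h := hp p.rep p.rep_nonzero p.mk_rep
  rw [Coordinates.conic, map_sub, map_mul, map_pow, sub_eq_zero] at h
  have hmk : ∀ t : K, ∀ ht : t ≠ 0, Projectivization.mk K (t • p.rep)
      (smul_ne_zero ht p.rep_nonzero) = p := by
    intro t ht
    conv_rhs => rw [← p.mk_rep]
    exact (Projectivization.mk_eq_mk_iff' K _ _ _ _).2 ⟨t, rfl⟩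
  by_cases h0 : eval p.rep (c.l 0) = 0
  · have h1 : eval p.rep (c.l 1) = 0 := by
      rw [h0, zero_mul] at h
      exact pow_eq_zero_iff two_ne_zero |>.1 h.symm
    have h2 : eval p.rep (c.l 2) ≠ 0 := by
      intro h2
      apply p.rep_nonzero
      apply c.eq_of_eval_eq
      intro i
      have hz := c.eval_smul_l 0 p.rep i
      rw [zero_smul, zero_mul] at hz
      rw [hz]
      fin_cases i
      · exact h0
      · exact h1
      · exact h2
    refine ⟨eval p.rep (c.l 2) • p.rep, ![0, eval p.rep (c.l 2)], smul_ne_zero h2 p.rep_nonzero,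
      hmk _ h2, fun hw => h2 (congrFun hw 1), ?_, ?_, ?_⟩
    · simp [c.eval_smul_l, h0]
    · simp [c.eval_smul_l, h1]
    · simp [c.eval_smul_l, sq]
  · refine ⟨eval p.rep (c.l 0) • p.rep, ![eval p.rep (c.l 0), eval p.rep (c.l 1)],
      smul_ne_zero h0 p.rep_nonzero, hmk _ h0, fun hw => h0 (congrFun hw 0), ?_, ?_, ?_⟩
    · simp [c.eval_smul_l, sq]
    · simp [c.eval_smul_l]
    · simp [c.eval_smul_l, h]

theorem exists_smul_of_rootForm_dvd {w w' : Fin 2 → K} (hw : w ≠ 0) (hw' : w' ≠ 0)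
    (h : rootForm w ∣ rootForm w') : ∃ t : K, w = t • w' := by
  rw [← lineMap_eq_zero_iff_rootForm_dvd hw,
    lineMap_of_isHomogeneous w (rootForm_isHomogeneous w')] at h
  have h1 : w' 1 * w 0 = w' 0 * w 1 := by
    have h2 : eval w (rootForm w') = 0 := by simpa using h
    simpa [rootForm, sub_eq_zero] using h2
  by_cases h0 : w' 0 = 0
  · have h2 : w' 1 ≠ 0 := fun h2 => hw' (by funext i; fin_cases i <;> simp [h0, h2])
    refine ⟨w 1 / w' 1, funext fun i => ?_⟩
    rw [h0, zero_mul] at h1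
    have h3 := (mul_eq_zero.1 h1).resolve_left h2
    fin_cases i
    · simp [h0, h3]
    · simp [h2]
  · refine ⟨w 0 / w' 0, funext fun i => ?_⟩
    fin_cases i
    · simp [h0]
    · simp only [Fin.mk_one, Pi.smul_apply, smul_eq_mul]
      field_simp
      linear_combination -h1

/-- Indices from r on repeat the point of index 0, so that every natural number yields a point of Z
and the parameters can be chosen for all indices. -/
theorem exists_enumeration {α : Type*} (Z : Finset α) {r : ℕ} (hr : Z.card = r) (hr0 : 0 < r) :
    ∃ pt : ℕ → α, (∀ i, pt i ∈ Z) ∧ (∀ p ∈ Z, ∃ i < r, pt i = p) ∧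
      ∀ i < r, ∀ j < r, pt i = pt j → i = j := by
  let e := Z.equivFinOfCardEq hr
  refine ⟨fun i => if h : i < r then (e.symm ⟨i, h⟩).1 else (e.symm ⟨0, hr0⟩).1, ?_, ?_, ?_⟩
  · intro i
    dsimp only
    split_ifs
    · exact (e.symm _).2
    · exact (e.symm _).2
  · intro p hp
    refine ⟨e ⟨p, hp⟩, (e ⟨p, hp⟩).2, ?_⟩
    simp
  · intro i hi j hj hij
    simp only [hi, hj, dif_pos] at hij
    have := e.symm.injective (Subtype.ext hij)
    simpa using this

theorem exists_conicPoints (Z : Finset (Plane K)) {r : ℕ} (hr : Z.card = r) (hr2 : 2 ≤ r)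
    (hZ : OnIrreducibleConic (Z : Set (Plane K))) : ∃ W : ConicPoints K r,
      idealOfPoints (Z : Set (Plane K)) = (Finset.range r).inf W.ideal := by
  obtain ⟨pt, hmem, hsurj, hinj⟩ := exists_enumeration Z hr (by omega)
  obtain ⟨Q, hQ, hirr, hvan⟩ := hZ
  obtain ⟨c, k, hk, hQc⟩ := exists_coordinates hQ hirr
    (fun h => absurd (hinj 0 (by omega) 1 (by omega) h) (by omega))
    (hvan _ (hmem 0)) (hvan _ (hmem 1))
  have hcon : ∀ i, VanishesAt c.conic (pt i) := by
    intro i v hv hvp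
    have := hvan _ (hmem i) v hv hvp
    rw [hQc, map_mul, eval_C] at this
    exact (mul_eq_zero.1 this).resolve_left hk
  choose v w hv hvp hw h0 h1 h2 using fun i => c.exists_param_of_vanishesAt (hcon i)
  let W : ConicPoints K r := ⟨c, v, w, hw, h0, h1, h2, by
    intro i hi j hj hji hdvd
    obtain ⟨t, ht⟩ := exists_smul_of_rootForm_dvd (hw i) (hw j) hdvd
    apply hji
    refine hinj j hj i hi ?_
    rw [← hvp i, ← hvp j, eq_comm]
    -- Proportional parameters give the same point, with factor t² because the coordinates are
    -- quadratic in the parameters.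
    refine (Projectivization.mk_eq_mk_iff' K _ _ _ _).2 ⟨t ^ 2, ?_⟩
    apply c.eq_of_eval_eq
    intro l
    rw [c.eval_smul_l]
    fin_cases l
    · change t ^ 2 * eval (v j) (c.l 0) = eval (v i) (c.l 0)
      rw [h0, h0, ht, Pi.smul_apply, smul_eq_mul]
      ring
    · change t ^ 2 * eval (v j) (c.l 1) = eval (v i) (c.l 1)
      rw [h1, h1, ht, Pi.smul_apply, Pi.smul_apply, smul_eq_mul, smul_eq_mul]
      ring
    · change t ^ 2 * eval (v j) (c.l 2) = eval (v i) (c.l 2)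
      rw [h2, h2, ht, Pi.smul_apply, smul_eq_mul]
      ring⟩
  have hW : ∀ i f, f ∈ W.ideal i ↔ lineMap (v i) f = 0 := fun i f => Iff.rfl
  refine ⟨W, le_antisymm ?_ ?_⟩
  · rw [idealOfPoints, Ideal.span_le]
    rintro f ⟨⟨n, hf⟩, hfZ⟩
    change f ∈ (Finset.range r).inf W.ideal
    rw [Submodule.mem_finsetInf]
    intro i _
    rw [hW, lineMap_of_isHomogeneous _ hf, hfZ _ (hmem i) (v i) (hv i) (hvp i), map_zero,
      zero_mul]
  · intro f hf
    rw [Submodule.mem_finsetInf] at hf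
    rw [← sum_homogeneousComponent f]
    refine Ideal.sum_mem _ fun n _ => Ideal.subset_span
      ⟨⟨n, homogeneousComponent_isHomogeneous n f⟩, fun p hp x hx hxp => ?_⟩
    obtain ⟨i, hi, rfl⟩ := hsurj p hp
    rw [← hvp i, Projectivization.mk_eq_mk_iff'] at hxp
    obtain ⟨t, rfl⟩ := hxp
    have := (hW i f).1 (hf i (Finset.mem_range.2 hi))
    rw [eval_smul_of_isHomogeneous (homogeneousComponent_isHomogeneous n f), ← coeff_lineMap,
      this, Polynomial.coeff_zero, mul_zero]

theorem HasMinimalFreeResolution.iff_eq {J : Ideal (CoordRing K)} {A B : Multiset ℤ}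
    (h : HasMinimalFreeResolution J A B) (G₀ G₁ : Multiset ℤ) :
    HasMinimalFreeResolution J G₀ G₁ ↔ G₀ = A ∧ G₁ = B := by
  constructor
  · exact fun h' => h'.unique h
  · rintro ⟨rfl, rfl⟩
    exact h

/-- For r = 3 the step r - 4 is -1. The index j = μ contributes the generator F^μ of degree 3μ, and
reversing the order of the remaining indices makes all three families coincide. -/
theorem twists_three_points (μ : ℕ) :
    twists (Finset.Icc 0 μ) (fun j => -4 * μ - j * (3 - 4)) +
        2 • twists (Finset.range μ) (fun j => -4 * μ - j * (3 - 4) - 1 + 1) =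
      {-(3 * (μ : ℤ))} + 3 • twists (Finset.range μ) (fun j => -(3 * (μ : ℤ)) - j - 1) := by
  rw [← twists_range_reflect μ fun j => -(3 * (μ : ℤ)) - j - 1, twists_Icc_zero,
    succ_nsmul' _ 2, add_comm (twists _ _) {_}, add_assoc]
  congr 1
  · congr 1
    ring
  · congr 2
    · funext j
      ring
    · congr 1
      funext j
      ring

theorem twists_three_points_syzygies (μ : ℕ) :
    twists (Finset.Icc 1 μ) (fun j => -4 * μ - j * (3 - 4) - 2) +
        2 • twists (Finset.range μ) (fun j => -4 * μ - j * (3 - 4) - 1) =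
      3 • twists (Finset.range μ) (fun j => -(3 * (μ : ℤ)) - j - 2) := by
  rw [← twists_range_reflect μ fun j => -(3 * (μ : ℤ)) - j - 2, twists_Icc_one,
    succ_nsmul' _ 2]
  congr 2
  · funext j
    ring
  · congr 1
    funext j
    ring

end FromPoints

end PlanePoints

/-! ### The three cases -/

theorem mainTheorem2 {K : Type*} [Field K] (Z : Finset (PlanePoints.Plane K)) (r m : ℕ)
    (hr : Z.card = r) (hr3 : 3 ≤ r)
    (hZ : PlanePoints.OnIrreducibleConic (Z : Set (PlanePoints.Plane K))) :
    (Even r → ∀ G₀ G₁ : Multiset ℤ,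
      PlanePoints.HasMinimalFreeResolution
          (PlanePoints.symbolicPower (PlanePoints.idealOfPoints (Z : Set (PlanePoints.Plane K))) m)
          G₀ G₁ ↔
        G₀ = PlanePoints.twists (Finset.Icc 0 m) (fun j => -2 * (m - j) - r * j / 2) ∧
        G₁ = PlanePoints.twists (Finset.Icc 1 m) (fun j => -2 * (m - j) - r * j / 2 - 2)) ∧
    (5 ≤ r → Odd r → Even m → ∀ G₀ G₁ : Multiset ℤ,
      PlanePoints.HasMinimalFreeResolution
          (PlanePoints.symbolicPower (PlanePoints.idealOfPoints (Z : Set (PlanePoints.Plane K))) m)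
          G₀ G₁ ↔
        G₀ = PlanePoints.twists (Finset.Icc 0 (m / 2)) (fun j => -2 * m - j * (r - 4)) +
          2 • PlanePoints.twists (Finset.range (m / 2))
            (fun j => -2 * m - j * (r - 4) - (r - 1) / 2 + 1) ∧
        G₁ = PlanePoints.twists (Finset.Icc 1 (m / 2)) (fun j => -2 * m - j * (r - 4) - 2) +
          2 • PlanePoints.twists (Finset.range (m / 2))
            (fun j => -2 * m - j * (r - 4) - (r - 1) / 2)) ∧
    (r = 3 → Even m → ∀ G₀ G₁ : Multiset ℤ,
      PlanePoints.HasMinimalFreeResolution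
          (PlanePoints.symbolicPower (PlanePoints.idealOfPoints (Z : Set (PlanePoints.Plane K))) m)
          G₀ G₁ ↔
        G₀ = {-(3 * (m : ℤ) / 2)} +
          3 • PlanePoints.twists (Finset.range (m / 2)) (fun j => -(3 * (m : ℤ) / 2) - j - 1) ∧
        G₁ = 3 • PlanePoints.twists (Finset.range (m / 2))
          (fun j => -(3 * (m : ℤ) / 2) - j - 2)) := by
  obtain ⟨W, hW⟩ := PlanePoints.exists_conicPoints Z hr (by omega) hZ
  have hsym : ∀ n, PlanePoints.symbolicPower
      (PlanePoints.idealOfPoints (Z : Set (PlanePoints.Plane K))) n = W.sym n := by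
    intro n
    rw [hW]
    rfl
  simp only [hsym]
  refine ⟨?_, ?_, ?_⟩
  · rintro ⟨k, hk⟩
    obtain ⟨F, hF⟩ := W.hasPointedResolution_even_card (k := k) (by omega) (by omega)
    -- The integer division is exact since r = 2k.
    have hdiv : ∀ j : ℤ, (r : ℤ) * j / 2 = k * j := fun j => by
      rw [show (r : ℤ) * j = 2 * (k * j) by rw [hk]; push_cast; ring]
      exact Int.mul_ediv_cancel_left _ two_ne_zero
    simp only [hdiv]
    exact (hF m).hasMinimalFreeResolution.iff_eq
  · rintro - ⟨k, hk⟩ ⟨μ, rfl⟩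
    obtain ⟨G⟩ := W.nonempty_oddGenerators (k := k) (by omega) hk
    have h := (G.hasPointedResolution (by omega) hk μ).hasMinimalFreeResolution.iff_eq
    rw [show (μ + μ) / 2 = μ by omega, show μ + μ = 2 * μ by omega,
      show ((r : ℤ) - 1) / 2 = k by omega,
      show -2 * ((2 * μ : ℕ) : ℤ) = -4 * μ by push_cast; ring]
    exact h
  · rintro rfl ⟨μ, rfl⟩
    obtain ⟨G⟩ := W.nonempty_oddGenerators (k := 1) one_ne_zero (by omega)
    have h := (G.hasPointedResolution one_ne_zero (by omega) μ).hasMinimalFreeResolution.iff_eq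
    rw [show (μ + μ) / 2 = μ by omega, show μ + μ = 2 * μ by omega,
      show 3 * ((2 * μ : ℕ) : ℤ) / 2 = 3 * μ by omega, ← PlanePoints.twists_three_points,
      ← PlanePoints.twists_three_points_syzygies]
    simpa [hr] using h
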